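/- Setting. A base station with $M\ge 2$ antennas serves $N\ge 1$ clusters of $K\ge 2$ single-antenna users, with $(N-1)K<M$. User $(n,k)$ has path loss $d_{n,k}^{-\alpha}$ ($d_{n,k}>0$), noise variance $\sigma_{n,k}^2>0$, signal power $P_{n,k}\ge 0$, and $B_{n,k}\in\{0,1,2,\dots\}$ feedback bits. Its fast-fading channel $\mathbf h_{n,k}\in\mathbb C^{1\times M}$ has i.i.d. circularly symmetric complex Gaussian entries of mean zero and unit variance. Its direction $\tilde{\mathbf h}_{n,k}=\mathbf h_{n,k}/\|\mathbf h_{n,k}\|$ is quantized to the codeword $\hat{\mathbf h}_{n,k}$ that maximizes $|\tilde{\mathbf h}_{n,k}\mathbf c^H|$ over a random codebook of $2^{B_{n,k}}$ independent vectors $\mathbf c$, each uniform on the unit sphere of $\mathbb C^{M}$; all channels and codewords are independent. Let $\theta_{n,k}\in[0,\pi/2]$ be given by $\cos\theta_{n,k}=|\tilde{\mathbf h}_{n,k}\hat{\mathbf h}_{n,k}^H|$, and let $\tilde{\mathbf e}_{n,k}$ be the normalized component of $\tilde{\mathbf h}_{n,k}$ orthogonal to $\hat{\mathbf h}_{n,k}$.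 The beamformer of cluster $n$ is $\mathbf w_n=\bar{\mathbf V}_n^{(0)}\mathbf p_n$, where the $M-(N-1)K$ orthonormal columns of $\bar{\mathbf V}_n^{(0)}$ are right-singular vectors, for the singular value $0$, of the matrix with rows $\hat{\mathbf h}_{m,j}$ ($m\ne n$, $1\le j\le K$), chosen as a measurable function of this matrix, and $\mathbf p_n$ is uniform on the unit sphere of $\mathbb C^{M-(N-1)K}$, independent of all channels and codewords. Put $$\gamma_{n,k}=\frac{d_{n,k}^{-\alpha}|\mathbf h_{n,k}\mathbf w_n|^2P_{n,k}}{d_{n,k}^{-\alpha}|\mathbf h_{n,k}\mathbf w_n|^2\sum_{j<k}P_{n,j}+d_{n,k}^{-\alpha}\sin^2\theta_{n,k}\|\mathbf h_{n,k}\|^2\sum_{i\ne n}|\tilde{\mathbf e}_{n,k}\mathbf w_i|^2\sum_{l=1}^KP_{i,l}+\sigma_{n,k}^2},$$ $$S^{(1)}_{n,k}=\frac{d_{n,k}^{-\alpha}}{\sigma_{n,k}^2}\sum_{j\le k}P_{n,j},\qquad S^{(2)}_{n,k}=\frac{d_{n,k}^{-\alpha}}{\sigma_{n,k}^2}\sum_{j<k}P_{n,j},\qquad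 S^{(3)}_{n,k}=\frac{d_{n,k}^{-\alpha}}{\sigma_{n,k}^2}\sum_{i\ne n}\sum_{j=1}^KP_{i,j},$$ $$R_{n,k}=\mathbb E\left[\log_2(1+\gamma_{n,k})\right],\qquad R^{ideal}_{n,k}=\mathbb E\left[\log_2\frac{1+S^{(1)}_{n,k}|\mathbf h_{n,k}\mathbf w_n|^2}{1+S^{(2)}_{n,k}|\mathbf h_{n,k}\mathbf w_n|^2}\right].$$ Theorem. For all $n$ and $k$ both expectations are finite, and the ergodic rate loss from quantization of the channel directions satisfies $$R^{ideal}_{n,k}-R_{n,k}\le\log_2\left(1+S^{(2)}_{n,k}+\Gamma\left(\tfrac{2M-1}{M-1}\right)2^{-\frac{B_{n,k}}{M-1}}S^{(3)}_{n,k}\right)-\log_2(e)\,e^{1/S^{(2)}_{n,k}}E_1\left(1/S^{(2)}_{n,k}\right),$$ where $E_1(x)=\int_1^\infty e^{-xt}t^{-1}\,dt$, and $e^{1/S}E_1(1/S)$ is read as its limit $0$ when $S=0$ (in particular for $k=1$). -/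

import Mathlib

open MeasureTheory ProbabilityTheory

noncomputable section

namespace NOMA

/-! ### Random vectors -/

/-- The space of complex `d`-vectors with the `L²` norm. -/
abbrev CVec (d : ℕ) : Type := EuclideanSpace ℂ (Fin d)

/-- The circularly symmetric complex Gaussian law with mean zero and unit variance. -/
def complexGaussian : Measure ℂ :=
  ((gaussianReal 0 (1 / 2)).prod (gaussianReal 0 (1 / 2))).map
    (fun z : ℝ × ℝ => (z.1 : ℂ) + (z.2 : ℂ) * Complex.I)

/-- The law of a `d`-vector with independent, circularly symmetric, unit variance complex
Gaussian entries (Rayleigh fading). -/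
def rayleighLaw (d : ℕ) : Measure (CVec d) :=
  (Measure.pi (fun _ : Fin d => complexGaussian)).map (WithLp.toLp 2)

/-- `ν` is the uniform (isotropic) distribution on the unit sphere of `ℂ^d`: the probability
measure carried by the unit sphere that is invariant under all unitary maps. -/
structure IsUniformOnSphere {d : ℕ} (ν : Measure (CVec d)) : Prop where
  isProbabilityMeasure : IsProbabilityMeasure ν
  norm_eq_one : ∀ᵐ x ∂ν, ‖x‖ = 1
  map_unitary : ∀ U : CVec d ≃ₗᵢ[ℂ] CVec d, ν.map (fun x => U x) = ν

/-- The product `x w` of a row vector `x` and a column vector `w` (no conjugation). -/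
def rowMul {d : ℕ} (x : CVec d) (w : Fin d → ℂ) : ℂ := x.ofLp ⬝ᵥ w

/-- The product `x cᴴ` of a row vector `x` and the conjugate transpose of a row vector `c`. -/
def rowMulStar {d : ℕ} (x c : CVec d) : ℂ := x.ofLp ⬝ᵥ star c.ofLp

/-- The direction `x / ‖x‖`. -/
def direction {d : ℕ} (x : CVec d) : CVec d := ((‖x‖⁻¹ : ℝ) : ℂ) • x

/-! ### Quantization of a direction -/

open Classical in
/-- The indices of the codewords `c` that maximize `|u cᴴ|`. -/
def maximizers {d b : ℕ} (C : Fin (2 ^ b) → CVec d) (u : CVec d) : Finset (Fin (2 ^ b)) :=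
  Finset.univ.filter (fun i => ∀ j, ‖rowMulStar u (C j)‖ ≤ ‖rowMulStar u (C i)‖)

theorem maximizers_nonempty {d b : ℕ} (C : Fin (2 ^ b) → CVec d) (u : CVec d) :
    (maximizers C u).Nonempty := by
  obtain ⟨i, hi⟩ := Finite.exists_max (fun i => ‖rowMulStar u (C i)‖)
  exact ⟨i, by simpa [maximizers] using hi⟩

/-- The codeword `c` that maximizes `|u cᴴ|` (the first one, should there be several). -/
def quantize {d b : ℕ} (C : Fin (2 ^ b) → CVec d) (u : CVec d) : CVec d :=
  C ((maximizers C u).min' (maximizers_nonempty C u))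

/-! ### The system -/

/-- The deterministic parameters: `N` clusters of `K` users each, `M` antennas. User `k = 0` is
the first user of its cluster. -/
structure System (M N K : ℕ) where
  /-- the path-loss exponent `α` -/
  pathLoss : ℝ
  /-- the distance of each user from the base station -/
  dist : Fin N → Fin K → ℝ
  /-- the noise variance at each user -/
  noiseVar : Fin N → Fin K → ℝ
  /-- the transmit power of the signal of each user -/
  power : Fin N → Fin K → ℝ
  /-- the number of feedback bits of each user -/
  bits : Fin N → Fin K → ℕ
  dist_pos : ∀ n k, 0 < dist n k
  noiseVar_pos : ∀ n k, 0 < noiseVar n k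
  power_nonneg : ∀ n k, 0 ≤ power n k

namespace System

variable {M N K : ℕ} (sys : System M N K)

/-- The large-scale fading `d_{n,k}^{-α}`. -/
def gain (n : Fin N) (k : Fin K) : ℝ := sys.dist n k ^ (-sys.pathLoss)

/-- `S⁽¹⁾_{n,k}`: own signal and the not cancelled signals of the same cluster. -/
def S1 (n : Fin N) (k : Fin K) : ℝ :=
  sys.gain n k / sys.noiseVar n k * ∑ j ∈ Finset.Iic k, sys.power n j

/-- `S⁽²⁾_{n,k}`: the not cancelled interfering signals of the same cluster. -/
def S2 (n : Fin N) (k : Fin K) : ℝ :=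
  sys.gain n k / sys.noiseVar n k * ∑ j ∈ Finset.Iio k, sys.power n j

/-- `S⁽³⁾_{n,k}`: the signals of the other clusters. -/
def S3 (n : Fin N) (k : Fin K) : ℝ :=
  sys.gain n k / sys.noiseVar n k * ∑ i ∈ Finset.univ.erase n, ∑ j, sys.power i j

end System

/-- For each cluster `n`, a rule that assigns to the matrix `H` of the (row) vectors of all users
outside cluster `n` a matrix `V H` whose `M - (N-1)K` columns are orthonormal vectors in the null
space of `H`, that is, right-singular vectors for the singular value zero. It is constrained only
where `H` has full row rank `(N-1)K`. -/
structure NullBasis (M N K : ℕ) where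
  /-- the matrix of right-singular vectors for the singular value zero -/
  V : (n : Fin N) → Matrix ({m : Fin N // m ≠ n} × Fin K) (Fin M) ℂ →
    Matrix (Fin M) (Fin (M - (N - 1) * K)) ℂ
  measurable_entry : ∀ n i j, Measurable
    (fun H : ({m : Fin N // m ≠ n} × Fin K) → Fin M → ℂ => V n (Matrix.of H) i j)
  mul_eq_zero : ∀ n H, H.rank = (N - 1) * K → H * V n H = 0
  orthonormal : ∀ n H, H.rank = (N - 1) * K → (V n H).conjTranspose * V n H = 1

/-- The random data: fast-fading channels, quantization codebooks, and the vectors `p_n` that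
select the beamformers inside the null spaces. -/
structure RandomData {M N K : ℕ} (sys : System M N K) (Ω : Type*) where
  /-- the fast-fading channel of each user -/
  h : Fin N → Fin K → Ω → CVec M
  /-- the codebook of each user -/
  codebook : (n : Fin N) → (k : Fin K) → Fin (2 ^ sys.bits n k) → Ω → CVec M
  /-- the coefficients of the beamformer of each cluster -/
  p : Fin N → Ω → CVec (M - (N - 1) * K)

namespace RandomData

variable {M N K : ℕ} {sys : System M N K} {Ω : Type*} (X : RandomData sys Ω)

/-- The channels and the codewords of all users as one family of random vectors. -/
def family :
    (Fin N × Fin K) ⊕ ((u : Fin N × Fin K) × Fin (2 ^ sys.bits u.1 u.2)) → Ω → CVec M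
  | Sum.inl u => X.h u.1 u.2
  | Sum.inr c => X.codebook c.1.1 c.1.2 c.2

/-- The probabilistic model: Rayleigh fading, random vector quantization with isotropic codewords,
all channels and codewords independent, and each `p_n` uniform on the unit sphere and independent
of the channels and codewords. -/
structure IsModel [MeasurableSpace Ω] (μ : Measure Ω) : Prop where
  measurable_h : ∀ n k, Measurable (X.h n k)
  measurable_codebook : ∀ n k i, Measurable (X.codebook n k i)
  measurable_p : ∀ n, Measurable (X.p n)
  law_h : ∀ n k, μ.map (X.h n k) = rayleighLaw M
  law_codebook : ∀ n k i, IsUniformOnSphere (μ.map (X.codebook n k i))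
  law_p : ∀ n, IsUniformOnSphere (μ.map (X.p n))
  indep : iIndepFun X.family μ
  indep_p : ∀ n, IndepFun (X.p n) (fun ω c => X.family c ω) μ

/-- The channel direction. -/
def hDir (n : Fin N) (k : Fin K) (ω : Ω) : CVec M := direction (X.h n k ω)

/-- The quantized channel direction. -/
def hHat (n : Fin N) (k : Fin K) (ω : Ω) : CVec M :=
  quantize (fun i => X.codebook n k i ω) (X.hDir n k ω)

/-- The angle `θ_{n,k} ∈ [0, π/2]` between the channel direction and its quantization. -/
def theta (n : Fin N) (k : Fin K) (ω : Ω) : ℝ :=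
  Real.arccos ‖rowMulStar (X.hDir n k ω) (X.hHat n k ω)‖

/-- The normalized quantization error: the normalized component of the channel direction that is
orthogonal to its quantization. -/
def err (n : Fin N) (k : Fin K) (ω : Ω) : CVec M :=
  direction (X.hDir n k ω -
    rowMulStar (X.hDir n k ω) (X.hHat n k ω) • X.hHat n k ω)

/-- The matrix whose rows are the quantized directions of all users outside cluster `n`. -/
def HBar (n : Fin N) (ω : Ω) : Matrix ({m : Fin N // m ≠ n} × Fin K) (Fin M) ℂ :=
  Matrix.of fun u => (X.hHat u.1 u.2 ω).ofLp

variable (F : NullBasis M N K)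

/-- The zero-forcing beamformer of cluster `n`. -/
def w (n : Fin N) (ω : Ω) : Fin M → ℂ :=
  (F.V n (X.HBar n ω)).mulVec (X.p n ω).ofLp

/-- The signal-to-interference-plus-noise ratio `γ_{n,k}` after interference cancellation. For the
first user of a cluster the sum over `j < k` is empty. -/
def sinr (n : Fin N) (k : Fin K) (ω : Ω) : ℝ :=
  sys.gain n k * ‖rowMul (X.h n k ω) (X.w F n ω)‖ ^ 2 * sys.power n k /
    (sys.gain n k * ‖rowMul (X.h n k ω) (X.w F n ω)‖ ^ 2 * (∑ j ∈ Finset.Iio k, sys.power n j)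
      + sys.gain n k * Real.sin (X.theta n k ω) ^ 2 * ‖X.h n k ω‖ ^ 2 *
          (∑ i ∈ Finset.univ.erase n,
            ‖rowMul (X.err n k ω) (X.w F i ω)‖ ^ 2 * ∑ l, sys.power i l)
      + sys.noiseVar n k)

/-- The instantaneous rate with quantized channel information. -/
def instRate (n : Fin N) (k : Fin K) (ω : Ω) : ℝ := Real.logb 2 (1 + X.sinr F n k ω)

/-- The instantaneous rate with perfect channel information. -/
def instRateIdeal (n : Fin N) (k : Fin K) (ω : Ω) : ℝ :=
  Real.logb 2 ((1 + sys.S1 n k * ‖rowMul (X.h n k ω) (X.w F n ω)‖ ^ 2) /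
    (1 + sys.S2 n k * ‖rowMul (X.h n k ω) (X.w F n ω)‖ ^ 2))

variable [MeasurableSpace Ω] (μ : Measure Ω)

/-- The ergodic rate `R_{n,k}`. -/
def rate (n : Fin N) (k : Fin K) : ℝ := ∫ ω, X.instRate F n k ω ∂μ

/-- The ergodic rate with perfect channel information. -/
def rateIdeal (n : Fin N) (k : Fin K) : ℝ := ∫ ω, X.instRateIdeal F n k ω ∂μ

/-- The ergodic rate loss `ΔR_{n,k}`. -/
def rateLoss (n : Fin N) (k : Fin K) : ℝ := X.rateIdeal F μ n k - X.rate F μ n k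

end RandomData

/-! ### The bound -/

/-- The generalized exponential integral `E_q(x) = ∫_1^∞ e^{-xt} / t^q dt`. -/
def expIntegral (q : ℕ) (x : ℝ) : ℝ := ∫ t in Set.Ioi (1 : ℝ), Real.exp (-(x * t)) / t ^ q

/-- `e^{1/s} E_1(1/s)`, with its limit `0` at `s = 0`. -/
def expE1 (s : ℝ) : ℝ := if s = 0 then 0 else Real.exp (1 / s) * expIntegral 1 (1 / s)

/-- The upper bound on the ergodic rate loss. -/
def System.lossBound {M N K : ℕ} (sys : System M N K) (n : Fin N) (k : Fin K) : ℝ :=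
  Real.logb 2 (1 + sys.S2 n k +
      Real.Gamma ((2 * (M : ℝ) - 1) / ((M : ℝ) - 1)) *
        (2 : ℝ) ^ (-((sys.bits n k : ℝ) / ((M : ℝ) - 1))) * sys.S3 n k)
    - Real.logb 2 (Real.exp 1) * expE1 (sys.S2 n k)

end NOMA

end

namespace NOMA

/-! ### The complex Gaussian law -/

/-! Write `g = |h w_n|²` for the effective gain and `I` for the interference of the other clusters
divided by the noise variance. Zero forcing makes `w_i`, `i ≠ n`, orthogonal to the quantized
direction of user `(n,k)`, so `sin²θ ‖h‖² |ẽ w_i|² = |h w_i|²` almost surely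
(`sin_sq_mul_norm_err`). The pointwise loss is then at most `log₂(1 + S⁽²⁾ g + I) - log₂(1 + S⁽²⁾
g)` (`logb_ideal_sub_le`).

The second term has an exact mean. The beamformer `w_n` is a unit vector independent of the channel
of user `(n,k)`, so `g` is exponential with mean one, and `E log(1 + s g)` is `expE1 s`
(`lintegral_log_complexGaussian`). For the first term, concavity of the logarithm leaves only `E g ≤
1` and a bound on `E I`.

The difficulty is `E |h w_i|²`, because `w_i` depends on the channel through its quantization.
Rotate the channel and the codebook of this one user by a common random unitary `U`. This preserves
the law, and `w_i` notices `U` only through the rotated codeword `U q`. The unitaries that fix `q`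
act transitively on the unit vectors orthogonal to `q`, so the energy of `w_i` spreads evenly over
the `M - 1` directions orthogonal to the codeword (`lintegral_unitary_inner_sq`). Hence `E |h w_i|²
= E[‖h‖² sin²θ] / (M - 1)` (`lintegral_cross_channel`).

Finally, the squared sine of the angle to one isotropic codeword has distribution function
`z^(M-1)`. The minimum over `2^B` independent codewords has tail `(1 - z^(M-1))^(2^B) ≤ exp(-2^B
z^(M-1))`, which integrates to `2^(-B/(M-1)) Γ(1 + 1/(M-1))` (`lintegral_quantization_error_le`).
With `E ‖h‖² = M` and the functional equation of `Γ` this becomes the constant of the theorem. -/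

instance : IsProbabilityMeasure complexGaussian :=
  Measure.isProbabilityMeasure_map (by fun_prop)

instance (d : ℕ) : IsProbabilityMeasure (rayleighLaw d) :=
  Measure.isProbabilityMeasure_map (by fun_prop)

/-- The squared modulus of a standard complex Gaussian is exponentially distributed. -/
theorem lintegral_complexGaussian_normSq {f : ℝ → ENNReal} (hf : Measurable f) :
    ∫⁻ z, f (‖z‖ ^ 2) ∂complexGaussian
      = ∫⁻ x in Set.Ioi (0 : ℝ), ENNReal.ofReal (Real.exp (-x)) * f x := by
  have hnorm : ∀ z : ℝ × ℝ, ‖(z.1 : ℂ) + (z.2 : ℂ) * Complex.I‖ ^ 2 = z.1 ^ 2 + z.2 ^ 2 := by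
    intro z
    rw [← Complex.normSq_eq_norm_sq, Complex.normSq_add_mul_I]
  have hpdf : ∀ x : ℝ, gaussianPDFReal 0 (1 / 2) x
      = (Real.sqrt Real.pi)⁻¹ * Real.exp (-x ^ 2) := by
    intro x
    simp [gaussianPDFReal]
    field_simp
  have himg : (fun r : ℝ => r ^ 2) '' Set.Ioi 0 = Set.Ioi 0 := by
    ext y
    constructor
    · rintro ⟨r, hr, rfl⟩
      exact pow_pos (Set.mem_Ioi.1 hr) 2
    · intro hy
      exact ⟨Real.sqrt y, Real.sqrt_pos.2 hy, Real.sq_sqrt (le_of_lt hy)⟩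
  have hinj : Set.InjOn (fun r : ℝ => r ^ 2) (Set.Ioi 0) := by
    intro a ha b hb h
    exact (pow_left_inj₀ (le_of_lt ha) (le_of_lt hb) two_ne_zero).1 h
  -- The substitution `x = r²` puts the exponential side into the radial form `2 r e^{-r²} f(r²)`.
  have hsub := lintegral_image_eq_lintegral_abs_deriv_mul (s := Set.Ioi (0 : ℝ))
    (f := fun r : ℝ => r ^ 2) (f' := fun r => 2 * r) measurableSet_Ioi
    (fun x _ => by simpa using (hasDerivAt_pow 2 x).hasDerivWithinAt) hinj
    (fun x => ENNReal.ofReal (Real.exp (-x)) * f x)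
  rw [himg] at hsub
  rw [hsub, complexGaussian, lintegral_map (by fun_prop) (by fun_prop)]
  simp_rw [hnorm]
  -- In polar coordinates the density `π⁻¹ e^{-r²}` is free of the angle, so the angular length `2π`
  -- and the Jacobian `r` give the weight `2 r e^{-r²}`.
  rw [gaussianReal_of_var_ne_zero _ (by norm_num),
    prod_withDensity (measurable_gaussianPDF _ _) (measurable_gaussianPDF _ _),
    lintegral_withDensity_eq_lintegral_mul _ (by fun_prop) (by fun_prop),
    ← Measure.volume_eq_prod, ← lintegral_comp_polarCoord_symm, polarCoord_target,
    Measure.volume_eq_prod, setLIntegral_prod]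
  · refine setLIntegral_congr_fun measurableSet_Ioi fun r hr => ?_
    have hr' : (0 : ℝ) < r := hr
    have hpolar : ∀ t : ℝ, (r * Real.cos t) ^ 2 + (r * Real.sin t) ^ 2 = r ^ 2 := by
      intro t
      have := Real.sin_sq_add_cos_sq t
      linear_combination r ^ 2 * this
    have hconst : ∀ t : ℝ, ENNReal.ofReal r • ((gaussianPDF 0 (1 / 2) (r * Real.cos t) *
          gaussianPDF 0 (1 / 2) (r * Real.sin t)) *
          f ((r * Real.cos t) ^ 2 + (r * Real.sin t) ^ 2))
        = ENNReal.ofReal (r * (Real.pi⁻¹ * Real.exp (-r ^ 2))) * f (r ^ 2) := by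
      intro t
      rw [hpolar, gaussianPDF_def, smul_eq_mul, ← mul_assoc]
      simp only [hpdf]
      rw [← ENNReal.ofReal_mul (by positivity), ← ENNReal.ofReal_mul (by positivity)]
      congr 3
      rw [mul_mul_mul_comm, ← Real.exp_add, ← mul_inv, Real.mul_self_sqrt Real.pi_pos.le,
        ← hpolar t]
      ring_nf
    simp only [polarCoord_symm_apply, Pi.mul_apply, hconst]
    rw [lintegral_const, Measure.restrict_apply_univ, Real.volume_Ioo, mul_comm, ← mul_assoc,
      ← ENNReal.ofReal_mul (by linarith [Real.pi_pos]),
      ← mul_assoc (ENNReal.ofReal _) (ENNReal.ofReal _),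
      ← ENNReal.ofReal_mul (by positivity)]
    congr 2
    rw [abs_of_pos (by linarith)]
    field_simp
    ring
  · apply Measurable.aemeasurable
    simp only [polarCoord_symm_apply]
    fun_prop

theorem complexGaussian_normSq_gt {y : ℝ} (hy : 0 ≤ y) :
    complexGaussian {z | y < ‖z‖ ^ 2} = ENNReal.ofReal (Real.exp (-y)) := by
  have hm : MeasurableSet {z : ℂ | y < ‖z‖ ^ 2} := measurableSet_lt (by fun_prop) (by fun_prop)
  have h := lintegral_complexGaussian_normSq (f := (Set.Ioi y).indicator 1)
    (measurable_one.indicator measurableSet_Ioi)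
  have hl : ∀ z : ℂ, (Set.Ioi y).indicator (1 : ℝ → ENNReal) (‖z‖ ^ 2)
      = {z : ℂ | y < ‖z‖ ^ 2}.indicator 1 z := fun z => rfl
  simp_rw [hl] at h
  rw [lintegral_indicator_one hm] at h
  rw [h]
  have hr : ∀ x : ℝ, ENNReal.ofReal (Real.exp (-x)) * (Set.Ioi y).indicator (1 : ℝ → ENNReal) x
      = (Set.Ioi y).indicator (fun x => ENNReal.ofReal (Real.exp (-x))) x := by
    intro x
    by_cases hx : x ∈ Set.Ioi y <;> simp [hx]
  simp_rw [hr]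
  rw [lintegral_indicator measurableSet_Ioi, Measure.restrict_restrict measurableSet_Ioi,
    Set.inter_eq_left.2 (Set.Ioi_subset_Ioi hy), ← integral_exp_neg_Ioi y,
    ofReal_integral_eq_lintegral_ofReal]
  · have := integrableOn_exp_mul_Ioi (a := -1) (by norm_num) y
    simp only [neg_mul, one_mul] at this
    exact this
  · exact Filter.Eventually.of_forall fun x => (Real.exp_pos _).le

theorem lintegral_exp_complexGaussian {l : ℝ} (hl : 0 ≤ l) :
    ∫⁻ z, ENNReal.ofReal (Real.exp (-(l * ‖z‖ ^ 2))) ∂complexGaussian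
      = ENNReal.ofReal (1 / (1 + l)) := by
  rw [lintegral_complexGaussian_normSq (f := fun x => ENNReal.ofReal (Real.exp (-(l * x))))
    (by fun_prop)]
  have h1 : -(1 + l) < 0 := by linarith
  have h := integral_exp_mul_Ioi h1 0
  have h2 : 1 / (1 + l) = ∫ x in Set.Ioi (0 : ℝ), Real.exp (-(1 + l) * x) := by
    rw [h, mul_zero, Real.exp_zero, neg_div_neg_eq]
  rw [h2, ofReal_integral_eq_lintegral_ofReal (integrableOn_exp_mul_Ioi h1 0)
    (Filter.Eventually.of_forall fun x => (Real.exp_pos _).le)]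
  refine lintegral_congr fun x => ?_
  rw [← ENNReal.ofReal_mul (Real.exp_pos _).le, ← Real.exp_add]
  ring_nf

theorem lintegral_normSq_complexGaussian :
    ∫⁻ z, ENNReal.ofReal (‖z‖ ^ 2) ∂complexGaussian = 1 := by
  rw [lintegral_complexGaussian_normSq (f := ENNReal.ofReal) (by fun_prop)]
  have h := Real.integral_rpow_mul_exp_neg_mul_Ioi (a := 2) (r := 1) (by norm_num) (by norm_num)
  have h2 : (1 : ℝ) = ∫ x in Set.Ioi (0 : ℝ), Real.exp (-x) * x := by
    norm_num at h
    simp_rw [mul_comm (Real.exp _)]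
    exact h.symm
  have hi : IntegrableOn (fun x : ℝ => Real.exp (-x) * x) (Set.Ioi 0) := by
    have := Real.GammaIntegral_convergent (s := 2) (by norm_num)
    norm_num at this
    exact this
  have h3 := ofReal_integral_eq_lintegral_ofReal hi
    ((ae_restrict_iff' measurableSet_Ioi).2 <| Filter.Eventually.of_forall fun x hx =>
      mul_nonneg (Real.exp_pos _).le (le_of_lt hx))
  rw [← h2, ENNReal.ofReal_one] at h3
  rw [h3]
  refine lintegral_congr fun x => ?_
  rw [ENNReal.ofReal_mul (Real.exp_pos _).le]

theorem charFunDual_gaussianReal_half (L : StrongDual ℝ ℝ) :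
    charFunDual (gaussianReal 0 (1 / 2)) L = Complex.exp (-((L 1 ^ 2 / 4 : ℝ) : ℂ)) := by
  have hL : (⇑L : ℝ → ℝ) = fun x => L 1 * x := by
    ext x
    conv_lhs => rw [← mul_one x, ← smul_eq_mul, map_smul, smul_eq_mul, mul_comm]
  rw [charFunDual_eq_charFun_map_one, hL, gaussianReal_map_const_mul, charFun_gaussianReal]
  congr 1
  push_cast
  ring_nf

theorem charFunDual_complexGaussian (L : StrongDual ℝ ℂ) :
    charFunDual complexGaussian L
      = Complex.exp (-(((L 1 ^ 2 + L Complex.I ^ 2) / 4 : ℝ) : ℂ)) := by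
  have h : complexGaussian = ((gaussianReal 0 (1 / 2)).prod (gaussianReal 0 (1 / 2))).map
      (Complex.equivRealProdCLM.symm : ℝ × ℝ →L[ℝ] ℂ) := by
    rw [complexGaussian]
    congr 1
    ext z
    exact (Complex.equivRealProd_symm_apply z).symm
  have h1 : Complex.equivRealProdCLM.symm (1, 0) = 1 :=
    (Complex.equivRealProd_symm_apply _).trans (by simp)
  have h2 : Complex.equivRealProdCLM.symm (0, 1) = Complex.I :=
    (Complex.equivRealProd_symm_apply _).trans (by simp)
  rw [h, charFunDual_map, charFunDual_prod, charFunDual_gaussianReal_half,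
    charFunDual_gaussianReal_half, ← Complex.exp_add]
  congr 1
  simp [h1, h2]
  ring

open scoped InnerProductSpace

/-! ### Row products as inner products -/

section Vectors

variable {d : ℕ}

theorem rowMulStar_eq_inner (x c : CVec d) : rowMulStar x c = ⟪c, x⟫_ℂ := rfl

/-- The entrywise conjugate of a vector. -/
def conjVec (w : Fin d → ℂ) : CVec d := WithLp.toLp 2 (star w)

theorem rowMul_eq_inner (x : CVec d) (w : Fin d → ℂ) : rowMul x w = ⟪conjVec w, x⟫_ℂ := by
  simp [rowMul, conjVec, EuclideanSpace.inner_eq_star_dotProduct]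

theorem measurable_conjVec : Measurable (conjVec : (Fin d → ℂ) → CVec d) := by
  unfold conjVec
  exact (by fun_prop : Continuous fun w : Fin d → ℂ => WithLp.toLp 2 (star w)).measurable

/-! ### Unitary maps -/

/-- Each vector extends to an orthonormal basis, and a unitary map carries one basis to the other.
-/
theorem exists_isometry_map_eq {x y : CVec d} (hx : ‖x‖ = 1) (hy : ‖y‖ = 1) :
    ∃ U : CVec d ≃ₗᵢ[ℂ] CVec d, U x = y := by
  obtain rfl | hd := Nat.eq_zero_or_pos d
  · simp [Subsingleton.elim x 0] at hx
  have hb : ∀ z : CVec d, ‖z‖ = 1 → ∃ b : OrthonormalBasis (Fin d) ℂ (CVec d), b ⟨0, hd⟩ = z := by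
    intro z hz
    obtain ⟨b, hb⟩ := Orthonormal.exists_orthonormalBasis_extension_of_card_eq
      (𝕜 := ℂ) (E := CVec d) (ι := Fin d) (by simp) (v := fun _ => z) (s := {⟨0, hd⟩}) (by
        constructor
        · intro i; simpa using hz
        · intro i j hij
          exact absurd (Subsingleton.elim i j) hij)
    exact ⟨b, hb _ rfl⟩
  obtain ⟨b, rfl⟩ := hb x hx
  obtain ⟨b', rfl⟩ := hb y hy
  exact ⟨b.equiv b' (Equiv.refl _), by simp⟩

/-- Same argument with bases that both contain `x`. This transitivity of the stabilizer is what
forces the energy of an interfering beam to be spread evenly. -/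
theorem exists_isometry_fix_map_eq {x e e' : CVec d} (hx : ‖x‖ = 1) (he : ‖e‖ = 1)
    (he' : ‖e'‖ = 1) (hxe : ⟪x, e⟫_ℂ = 0) (hxe' : ⟪x, e'⟫_ℂ = 0) :
    ∃ U : CVec d ≃ₗᵢ[ℂ] CVec d, U x = x ∧ U e = e' := by
  -- The index `none` carries `x` and the index `some 0` carries `z`. The form `i.1 = 0` makes sense
  -- before `2 ≤ d` is known.
  have hb : ∀ z : CVec d, ‖z‖ = 1 → ⟪x, z⟫_ℂ = 0 → ∃ b : OrthonormalBasis (Option (Fin (d - 1))) ℂ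
      (CVec d), b none = x ∧ ∀ i : Fin (d - 1), i.1 = 0 → b (some i) = z := by
    intro z hz hxz
    have hd : 1 ≤ d := by
      by_contra h
      obtain rfl : d = 0 := by omega
      simp [Subsingleton.elim x 0] at hx
    obtain ⟨b, hb⟩ := Orthonormal.exists_orthonormalBasis_extension_of_card_eq
      (𝕜 := ℂ) (E := CVec d) (ι := Option (Fin (d - 1))) (by simp; omega)
      (v := fun i => i.elim x fun _ => z) (s := {i | ∀ j, i = some j → j.1 = 0}) (by
        have hzx : ⟪z, x⟫_ℂ = 0 := by rw [← inner_conj_symm, hxz, map_zero]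
        constructor
        · rintro ⟨_ | i, hi⟩
          · simpa using hx
          · simpa using hz
        · rintro ⟨_ | i, hi⟩ ⟨_ | j, hj⟩ hij
          · exact absurd rfl hij
          · simpa using hxz
          · simpa using hzx
          · exact absurd (Subtype.ext (congrArg some (Fin.ext ((hi i rfl).trans (hj j rfl).symm))))
              hij)
    exact ⟨b, hb none (by simp), fun i hi => hb (some i) (by
      intro j hj
      cases hj
      exact hi)⟩
  have hd : 2 ≤ d := by
    by_contra h
    have hli : LinearIndependent ℂ ![x, e] := by
      have : Orthonormal ℂ ![x, e] := by
        constructor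
        · intro i; fin_cases i <;> simpa
        · intro i j hij
          have hex : ⟪e, x⟫_ℂ = 0 := by rw [← inner_conj_symm, hxe, map_zero]
          fin_cases i <;> fin_cases j <;> simp_all
      exact this.linearIndependent
    have := hli.fintype_card_le_finrank
    simp at this
    omega
  obtain ⟨b, hb0, hb1⟩ := hb e he hxe
  obtain ⟨b', hb0', hb1'⟩ := hb e' he' hxe'
  refine ⟨b.equiv b' (Equiv.refl _), ?_, ?_⟩
  · conv_lhs => rw [← hb0]
    rw [OrthonormalBasis.equiv_apply_basis, Equiv.refl_apply, hb0']
  · conv_lhs => rw [← hb1 ⟨0, by omega⟩ rfl]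
    rw [OrthonormalBasis.equiv_apply_basis, Equiv.refl_apply, hb1' _ rfl]

/-! ### Rayleigh fading -/

/-- The value depends on `a` only through its norm, which is where unitary invariance comes from. -/
theorem charFunDual_rayleighLaw (L : StrongDual ℝ (CVec d)) {a : CVec d}
    (ha : ∀ x, L x = (⟪a, x⟫_ℂ).re) :
    charFunDual (rayleighLaw d) L = Complex.exp (-((‖a‖ ^ 2 / 4 : ℝ) : ℂ)) := by
  have hs : ∀ (j : Fin d) (z : ℂ), (L ∘SL
      ((PiLp.continuousLinearEquiv 2 ℝ fun _ : Fin d => ℂ).symm :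
        (Fin d → ℂ) →L[ℝ] PiLp 2 fun _ : Fin d => ℂ) ∘SL
        ContinuousLinearMap.single ℝ (fun _ : Fin d => ℂ) j) z
      = (z * star (a j)).re := by
    intro j z
    have : (PiLp.continuousLinearEquiv 2 ℝ fun _ : Fin d => ℂ).symm
        (ContinuousLinearMap.single ℝ (fun _ : Fin d => ℂ) j z)
          = EuclideanSpace.single j z := rfl
    rw [ContinuousLinearMap.comp_apply, ContinuousLinearMap.comp_apply]
    erw [this]
    rw [ha, EuclideanSpace.inner_single_right]
    rfl
  rw [rayleighLaw, charFunDual_pi']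
  simp_rw [charFunDual_complexGaussian, hs]
  rw [← Complex.exp_sum, EuclideanSpace.norm_sq_eq, Finset.sum_div]
  push_cast
  rw [← Finset.sum_neg_distrib]
  congr 1
  refine Finset.sum_congr rfl fun j _ => ?_
  have : ‖a j‖ ^ 2 = (a j).re ^ 2 + (a j).im ^ 2 := by
    rw [← Complex.normSq_eq_norm_sq, Complex.normSq_apply]; ring
  norm_cast
  rw [this]
  simp

/-- Riesz representation in real coordinates: the `j`-th entry of `a` is `L(e_j) + i L(i e_j)`. -/
theorem exists_inner_re_eq (L : StrongDual ℝ (CVec d)) :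
    ∃ a : CVec d, ∀ x, L x = (⟪a, x⟫_ℂ).re := by
  refine ⟨WithLp.toLp 2 fun j => (L (EuclideanSpace.single j 1) : ℂ) +
    (L (EuclideanSpace.single j Complex.I) : ℂ) * Complex.I, fun x => ?_⟩
  have hx : x = ∑ j, ((x j).re • EuclideanSpace.single j (1 : ℂ) +
      (x j).im • EuclideanSpace.single j Complex.I) := by
    ext i
    simp [Finset.sum_apply, Pi.single_apply, Finset.sum_add_distrib]
  conv_lhs => rw [hx]
  rw [map_sum, PiLp.inner_apply, Complex.re_sum]
  refine Finset.sum_congr rfl fun j _ => ?_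
  simp

/-- Composing a functional with `U` replaces its representing vector `a` by `U⁻¹ a`, of the same
norm, so the characteristic function is unchanged. -/
theorem rayleighLaw_map_unitary (U : CVec d ≃ₗᵢ[ℂ] CVec d) :
    (rayleighLaw d).map U = rayleighLaw d := by
  let V : CVec d →L[ℝ] CVec d := (U.toContinuousLinearEquiv : CVec d →L[ℂ] CVec d).restrictScalars ℝ
  have hV : (⇑U : CVec d → CVec d) = V := rfl
  have : IsProbabilityMeasure ((rayleighLaw d).map U) :=
    Measure.isProbabilityMeasure_map U.continuous.measurable.aemeasurable
  refine Measure.ext_of_charFunDual (funext fun L => ?_)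
  obtain ⟨a, ha⟩ := exists_inner_re_eq L
  rw [hV, charFunDual_map, charFunDual_rayleighLaw L ha,
    charFunDual_rayleighLaw (L ∘SL V) (a := U.symm a) (fun x => ?_), LinearIsometryEquiv.norm_map]
  rw [ContinuousLinearMap.comp_apply, ha, ← hV, ← U.inner_map_map (U.symm a) x,
    U.apply_symm_apply]

theorem lintegral_rayleighLaw_coord (i : Fin d) {f : ℂ → ENNReal} (hf : Measurable f) :
    ∫⁻ h, f (h i) ∂rayleighLaw d = ∫⁻ z, f z ∂complexGaussian := by
  rw [rayleighLaw, lintegral_map (by fun_prop) (by fun_prop)]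
  exact (measurePreserving_eval (fun _ : Fin d => complexGaussian) i).lintegral_comp hf

/-- The projection of a Rayleigh vector on a unit vector is a standard complex Gaussian, up to its
phase. -/
theorem lintegral_rayleighLaw_inner {a : CVec d} (ha : ‖a‖ = 1) {f : ℝ → ENNReal}
    (hf : Measurable f) :
    ∫⁻ h, f ‖⟪a, h⟫_ℂ‖ ∂rayleighLaw d = ∫⁻ z, f ‖z‖ ∂complexGaussian := by
  obtain rfl | hd := Nat.eq_zero_or_pos d
  · simp [Subsingleton.elim a 0] at ha
  obtain ⟨U, hU⟩ := exists_isometry_map_eq (x := a) (y := EuclideanSpace.single ⟨0, hd⟩ (1 : ℂ)) ha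
    (by simp)
  have hm : Measurable fun h : CVec d => f ‖h ⟨0, hd⟩‖ := by fun_prop
  rw [← lintegral_rayleighLaw_coord ⟨0, hd⟩ (f := fun z => f ‖z‖) (by fun_prop)]
  conv_rhs => rw [← rayleighLaw_map_unitary U, lintegral_map hm U.continuous.measurable]
  refine lintegral_congr fun h => ?_
  rw [← U.inner_map_map a h, hU, EuclideanSpace.inner_single_left, map_one, one_mul]

theorem lintegral_norm_sq_rayleighLaw :
    ∫⁻ h, ENNReal.ofReal (‖h‖ ^ 2) ∂rayleighLaw d = d := by
  have : ∀ h : CVec d, ENNReal.ofReal (‖h‖ ^ 2) = ∑ i, ENNReal.ofReal (‖h i‖ ^ 2) := by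
    intro h
    rw [EuclideanSpace.norm_sq_eq, ENNReal.ofReal_sum_of_nonneg fun _ _ => by positivity]
  simp_rw [this]
  rw [lintegral_finsetSum _ fun i _ => by fun_prop]
  simp_rw [fun i => lintegral_rayleighLaw_coord (d := d) i
    (f := fun z => ENNReal.ofReal (‖z‖ ^ 2)) (by fun_prop), lintegral_normSq_complexGaussian]
  simp

theorem rayleighLaw_ae_ne_zero (hd : 0 < d) : ∀ᵐ h ∂rayleighLaw d, h ≠ 0 := by
  have h1 := lintegral_rayleighLaw_coord (⟨0, hd⟩ : Fin d)
    (f := {z : ℂ | 0 < ‖z‖ ^ 2}.indicator 1)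
    (measurable_one.indicator (measurableSet_lt (by fun_prop) (by fun_prop)))
  rw [lintegral_indicator_one (measurableSet_lt (by fun_prop) (by fun_prop)),
    complexGaussian_normSq_gt le_rfl] at h1
  have hm : MeasurableSet {h : CVec d | 0 < ‖h ⟨0, hd⟩‖ ^ 2} :=
    measurableSet_lt (by fun_prop) (by fun_prop)
  have h2 : rayleighLaw d {h : CVec d | 0 < ‖h ⟨0, hd⟩‖ ^ 2} = 1 := by
    rw [← lintegral_indicator_one hm]
    rw [neg_zero, Real.exp_zero, ENNReal.ofReal_one] at h1
    exact h1
  have h3 := (mem_ae_iff_prob_eq_one hm).2 h2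
  filter_upwards [h3] with h hh h0
  simp [h0] at hh

end Vectors

/-! ### Isotropic vectors -/

/-- A coordinate of a product measure may be resampled. -/
theorem lintegral_pi_update {ι E : Type*} [Fintype ι] [DecidableEq ι] [MeasurableSpace E]
    (ν : ι → Measure E) [∀ i, IsProbabilityMeasure (ν i)] (c : ι) {f : (ι → E) → ENNReal}
    (hf : Measurable f) :
    ∫⁻ x, f x ∂Measure.pi ν
      = ∫⁻ x, ∫⁻ v, f (Function.update x c v) ∂ν c ∂Measure.pi ν := by
  have hm : Measurable fun p : (ι → E) × E => Function.update p.1 c p.2 := by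
    refine measurable_pi_lambda _ fun i => ?_
    by_cases hi : i = c
    · subst hi
      simpa using measurable_snd
    · simpa [hi, Function.comp_def] using (measurable_pi_apply i).comp measurable_fst
  have hmap : ((Measure.pi ν).prod (ν c)).map
      (fun p : (ι → E) × E => Function.update p.1 c p.2) = Measure.pi ν := by
    refine (Measure.pi_eq fun s hs => ?_).symm
    have hpre : (fun p : (ι → E) × E => Function.update p.1 c p.2) ⁻¹' Set.univ.pi s
        = (Set.univ.pi (Function.update s c Set.univ)) ×ˢ s c := by
      ext p
      simp only [Set.mem_preimage, Set.mem_pi, Set.mem_univ, true_implies, Set.mem_prod]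
      constructor
      · intro h
        refine ⟨fun i => ?_, by simpa using h c⟩
        by_cases hi : i = c
        · subst hi; simp
        · simpa [hi] using h i
      · rintro ⟨h1, h2⟩ i
        by_cases hi : i = c
        · subst hi; simpa using h2
        · simpa [hi] using h1 i
    rw [Measure.map_apply hm (MeasurableSet.univ_pi hs), hpre, Measure.prod_prod, Measure.pi_pi,
      ← Finset.mul_prod_erase _ _ (Finset.mem_univ c),
      ← Finset.mul_prod_erase Finset.univ (fun i => ν i (s i)) (Finset.mem_univ c)]
    simp only [Function.update_self, measure_univ, one_mul]
    rw [mul_comm]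
    congr 1
    refine Finset.prod_congr rfl fun i hi => ?_
    rw [Function.update_of_ne (Finset.ne_of_mem_erase hi)]
  conv_lhs => rw [← hmap, lintegral_map hf hm]
  exact lintegral_prod _ (hf.comp hm).aemeasurable

/-- With `l = (1 - z)/z` the event reads `|h_i|² > l ∑_{j ≠ i} |h_j|²`. Given the other entries, the
exponential tail of `|h_i|²` factors into `∏ exp(-l |h_j|²)`; each of these `d - 1` independent
factors has mean `1/(1 + l) = z`. -/
theorem rayleighLaw_coord_fraction {d : ℕ} (i : Fin d) {z : ℝ} (hz : 0 < z) (hz1 : z ≤ 1) :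
    rayleighLaw d {h | ‖h‖ ^ 2 - ‖h i‖ ^ 2 < z * ‖h‖ ^ 2} = ENNReal.ofReal (z ^ (d - 1)) := by
  have hset : MeasurableSet {h : CVec d | ‖h‖ ^ 2 - ‖h i‖ ^ 2 < z * ‖h‖ ^ 2} :=
    measurableSet_lt (by fun_prop) (by fun_prop)
  have hl : 0 ≤ (1 - z) / z := div_nonneg (by linarith) hz.le
  have hpre : WithLp.toLp 2 ⁻¹' {h : CVec d | ‖h‖ ^ 2 - ‖h i‖ ^ 2 < z * ‖h‖ ^ 2}
      = {x : Fin d → ℂ | (1 - z) / z * ∑ j ∈ Finset.univ.erase i, ‖x j‖ ^ 2 < ‖x i‖ ^ 2} := by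
    ext x
    simp only [Set.mem_preimage, Set.mem_ofPred_eq, EuclideanSpace.norm_sq_eq]
    rw [← Finset.add_sum_erase _ _ (Finset.mem_univ i), div_mul_eq_mul_div, div_lt_iff₀ hz]
    constructor <;> intro h <;> nlinarith
  have hset' : MeasurableSet
      {x : Fin d → ℂ | (1 - z) / z * ∑ j ∈ Finset.univ.erase i, ‖x j‖ ^ 2 < ‖x i‖ ^ 2} :=
    measurableSet_lt (by fun_prop) (by fun_prop)
  rw [rayleighLaw, Measure.map_apply (by fun_prop) hset, hpre, ← lintegral_indicator_one hset',
    lintegral_pi_update (fun _ : Fin d => complexGaussian) i (measurable_one.indicator hset')]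
  have hinner : ∀ x : Fin d → ℂ, ∫⁻ v,
      {x : Fin d → ℂ | (1 - z) / z * ∑ j ∈ Finset.univ.erase i, ‖x j‖ ^ 2 < ‖x i‖ ^ 2}.indicator
        (1 : (Fin d → ℂ) → ENNReal) (Function.update x i v) ∂complexGaussian
      = ∏ j ∈ Finset.univ.erase i,
          ENNReal.ofReal (Real.exp (-((1 - z) / z * ‖x j‖ ^ 2))) := by
    intro x
    have hS : 0 ≤ (1 - z) / z * ∑ j ∈ Finset.univ.erase i, ‖x j‖ ^ 2 :=
      mul_nonneg hl (Finset.sum_nonneg fun _ _ => by positivity)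
    rw [← ENNReal.ofReal_prod_of_nonneg fun _ _ => (Real.exp_pos _).le, ← Real.exp_sum,
      Finset.sum_neg_distrib, ← Finset.mul_sum, ← complexGaussian_normSq_gt hS,
      ← lintegral_indicator_one (measurableSet_lt (by fun_prop) (by fun_prop))]
    refine lintegral_congr fun v => ?_
    have hsum : ∑ j ∈ Finset.univ.erase i, ‖Function.update x i v j‖ ^ 2
        = ∑ j ∈ Finset.univ.erase i, ‖x j‖ ^ 2 :=
      Finset.sum_congr rfl fun j hj => by
        rw [Function.update_of_ne (Finset.ne_of_mem_erase hj)]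
    simp only [Set.indicator_apply, Set.mem_ofPred_eq, hsum, Function.update_self, Pi.one_apply]
  simp_rw [hinner]
  have hind := iIndepFun_pi (μ := fun _ : Fin d => complexGaussian)
    (X := fun _ v => ENNReal.ofReal (Real.exp (-((1 - z) / z * ‖v‖ ^ 2))))
    (fun _ => by fun_prop)
  rw [lintegral_prod_eq_prod_lintegral_of_indepFun _ _ hind (fun j => by fun_prop)]
  have hone : ∀ j : Fin d, ∫⁻ x : Fin d → ℂ,
      ENNReal.ofReal (Real.exp (-((1 - z) / z * ‖x j‖ ^ 2)))
        ∂Measure.pi (fun _ : Fin d => complexGaussian) = ENNReal.ofReal z := by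
    intro j
    rw [(measurePreserving_eval (fun _ : Fin d => complexGaussian) j).lintegral_comp
      (f := fun v => ENNReal.ofReal (Real.exp (-((1 - z) / z * ‖v‖ ^ 2)))) (by fun_prop),
      lintegral_exp_complexGaussian hl]
    congr 1
    field_simp
    ring
  simp_rw [hone]
  rw [Finset.prod_const, Finset.card_erase_of_mem (Finset.mem_univ i), Finset.card_univ,
    Fintype.card_fin, ENNReal.ofReal_pow hz.le]

theorem rayleighLaw_inner_fraction {d : ℕ} {a : CVec d} (ha : ‖a‖ = 1) {z : ℝ} (hz : 0 < z)
    (hz1 : z ≤ 1) :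
    rayleighLaw d {h | ‖h‖ ^ 2 - ‖⟪a, h⟫_ℂ‖ ^ 2 < z * ‖h‖ ^ 2} = ENNReal.ofReal (z ^ (d - 1)) := by
  obtain rfl | hd := Nat.eq_zero_or_pos d
  · simp [Subsingleton.elim a 0] at ha
  obtain ⟨U, hU⟩ := exists_isometry_map_eq (x := a) (y := EuclideanSpace.single ⟨0, hd⟩ (1 : ℂ)) ha
    (by simp)
  rw [← rayleighLaw_coord_fraction ⟨0, hd⟩ hz hz1]
  conv_rhs => rw [← rayleighLaw_map_unitary U, Measure.map_apply U.continuous.measurable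
    (measurableSet_lt (by fun_prop) (by fun_prop))]
  congr 1
  ext h
  rw [Set.mem_preimage, Set.mem_ofPred_eq, Set.mem_ofPred_eq, U.norm_map, ← U.inner_map_map a h, hU,
    EuclideanSpace.inner_single_left, map_one, one_mul]

theorem IsUniformOnSphere.lintegral_inner_eq {d : ℕ} {ν : Measure (CVec d)}
    (hν : IsUniformOnSphere ν) {u u' : CVec d} (hu : ‖u‖ = 1) (hu' : ‖u'‖ = 1) {f : ℝ → ENNReal}
    (hf : Measurable f) :
    ∫⁻ c, f ‖⟪u, c⟫_ℂ‖ ∂ν = ∫⁻ c, f ‖⟪u', c⟫_ℂ‖ ∂ν := by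
  obtain ⟨U, rfl⟩ := exists_isometry_map_eq hu hu'
  conv_rhs => rw [← hν.map_unitary U, lintegral_map (by fun_prop) U.continuous.measurable]
  simp_rw [U.inner_map_map]

/-- The squared distance of a fixed direction from an isotropic one is `Beta(d - 1, 1)`. -/
theorem IsUniformOnSphere.measure_sin_sq_lt {d : ℕ} {ν : Measure (CVec d)}
    (hν : IsUniformOnSphere ν) {u : CVec d} (hu : ‖u‖ = 1) {z : ℝ} (hz : 0 < z) (hz1 : z ≤ 1) :
    ν {c | 1 - ‖⟪u, c⟫_ℂ‖ ^ 2 < z} = ENNReal.ofReal (z ^ (d - 1)) := by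
  have := hν.isProbabilityMeasure
  have hd : 0 < d := by
    rcases Nat.eq_zero_or_pos d with rfl | h
    · simp [Subsingleton.elim u 0] at hu
    · exact h
  have hI : MeasurableSet {t : ℝ | 1 - t ^ 2 < z} := measurableSet_lt (by fun_prop) (by fun_prop)
  have hconst : ∀ u' : CVec d, ‖u'‖ = 1 →
      ν {c | 1 - ‖⟪u', c⟫_ℂ‖ ^ 2 < z} = ν {c | 1 - ‖⟪u, c⟫_ℂ‖ ^ 2 < z} := by
    intro u' hu'
    have h := hν.lintegral_inner_eq hu' hu (f := {t : ℝ | 1 - t ^ 2 < z}.indicator 1)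
      (measurable_one.indicator hI)
    rw [← lintegral_indicator_one (measurableSet_lt (by fun_prop) (by fun_prop)),
      ← lintegral_indicator_one (measurableSet_lt (by fun_prop) (by fun_prop))]
    exact h
  -- By invariance the probability is the same for every unit `u`, so `u` may be replaced by the
  -- direction of a Rayleigh vector `h`. Fubini then exchanges the roles: for a fixed codeword the
  -- event is about `h` alone, whose law is explicit. The homogeneous form of the inequality avoids
  -- dividing by `‖h‖`.
  have hswap : ∫⁻ h, ν {c | ‖h‖ ^ 2 - ‖⟪h, c⟫_ℂ‖ ^ 2 < z * ‖h‖ ^ 2} ∂rayleighLaw d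
      = ∫⁻ c, rayleighLaw d {h | ‖h‖ ^ 2 - ‖⟪h, c⟫_ℂ‖ ^ 2 < z * ‖h‖ ^ 2} ∂ν := by
    have hm : MeasurableSet
        {p : CVec d × CVec d | ‖p.1‖ ^ 2 - ‖⟪p.1, p.2⟫_ℂ‖ ^ 2 < z * ‖p.1‖ ^ 2} :=
      measurableSet_lt (by fun_prop) (by fun_prop)
    have h1 := Measure.prod_apply (μ := rayleighLaw d) (ν := ν) hm
    have h2 := Measure.prod_apply_symm (μ := rayleighLaw d) (ν := ν) hm
    exact h1.symm.trans h2
  have hleft : ∀ᵐ h ∂rayleighLaw d, ν {c | ‖h‖ ^ 2 - ‖⟪h, c⟫_ℂ‖ ^ 2 < z * ‖h‖ ^ 2}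
      = ν {c | 1 - ‖⟪u, c⟫_ℂ‖ ^ 2 < z} := by
    filter_upwards [rayleighLaw_ae_ne_zero hd] with h hh
    have hpos : 0 < ‖h‖ := norm_pos_iff.2 hh
    rw [← hconst (((‖h‖⁻¹ : ℝ) : ℂ) • h) (by
      rw [norm_smul, Complex.norm_real, norm_inv, norm_norm, inv_mul_cancel₀ hpos.ne'])]
    congr 1
    ext c
    rw [Set.mem_ofPred_eq, Set.mem_ofPred_eq, inner_smul_left, norm_mul, RCLike.norm_conj,
      Complex.norm_real, norm_inv, norm_norm]
    rw [← mul_lt_mul_iff_of_pos_left (a := ‖h‖ ^ 2) (b := 1 - _) (by positivity)]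
    have : ‖h‖ ^ 2 * (1 - (‖h‖⁻¹ * ‖⟪h, c⟫_ℂ‖) ^ 2) = ‖h‖ ^ 2 - ‖⟪h, c⟫_ℂ‖ ^ 2 := by
      field_simp
    rw [this, mul_comm z]
  have hright : ∀ᵐ c ∂ν, rayleighLaw d {h | ‖h‖ ^ 2 - ‖⟪h, c⟫_ℂ‖ ^ 2 < z * ‖h‖ ^ 2}
      = ENNReal.ofReal (z ^ (d - 1)) := by
    filter_upwards [hν.norm_eq_one] with c hc
    rw [← rayleighLaw_inner_fraction hc hz hz1]
    simp_rw [norm_inner_symm c]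
  rw [lintegral_congr_ae hleft, lintegral_congr_ae hright] at hswap
  simpa using hswap

/-- The case `z = 1` of the Beta law: an isotropic vector almost surely avoids a given hyperplane.
This gives the linear independence of codewords. -/
theorem IsUniformOnSphere.ae_inner_ne_zero {d : ℕ} {ν : Measure (CVec d)}
    (hν : IsUniformOnSphere ν) {u : CVec d} (hu : ‖u‖ = 1) : ∀ᵐ c ∂ν, ⟪u, c⟫_ℂ ≠ 0 := by
  have := hν.isProbabilityMeasure
  have h1 : ν {c | 1 - ‖⟪u, c⟫_ℂ‖ ^ 2 < 1} = 1 := by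
    rw [hν.measure_sin_sq_lt hu one_pos le_rfl]; simp
  have h2 := (mem_ae_iff_prob_eq_one (measurableSet_lt (by fun_prop) (by fun_prop))).2 h1
  filter_upwards [h2] with c hc h0
  simp [h0] at hc

/-- The exact tail `1 - z^(d-1)` on `(0, 1]` is relaxed by `1 - t ≤ e^{-t}`. The relaxed bound holds
for all `z > 0`, and its `n`-th power integrates over the half line to a Gamma function. -/
theorem IsUniformOnSphere.measure_lt_sin_sq_le {d : ℕ} {ν : Measure (CVec d)}
    (hν : IsUniformOnSphere ν) {u : CVec d} (hu : ‖u‖ = 1) {z : ℝ} (hz : 0 < z) :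
    ν {c | z < 1 - ‖⟪u, c⟫_ℂ‖ ^ 2} ≤ ENNReal.ofReal (Real.exp (-z ^ (d - 1))) := by
  have := hν.isProbabilityMeasure
  rcases lt_or_ge 1 z with h1 | h1
  · have : {c : CVec d | z < 1 - ‖⟪u, c⟫_ℂ‖ ^ 2} = ∅ := by
      ext c
      simp only [Set.mem_ofPred_eq, Set.mem_empty_iff_false, iff_false, not_lt]
      nlinarith [sq_nonneg ‖⟪u, c⟫_ℂ‖]
    simp [this]
  · calc ν {c | z < 1 - ‖⟪u, c⟫_ℂ‖ ^ 2} ≤ ν {c | 1 - ‖⟪u, c⟫_ℂ‖ ^ 2 < z}ᶜ :=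
        measure_mono fun c hc => by
          simp only [Set.mem_compl_iff, Set.mem_ofPred_eq, not_lt] at hc ⊢
          exact hc.le
      _ = ENNReal.ofReal (1 - z ^ (d - 1)) := by
        rw [measure_compl (measurableSet_lt (by fun_prop) (by fun_prop)) (measure_ne_top _ _),
          hν.measure_sin_sq_lt hu hz h1, measure_univ, ENNReal.ofReal_sub _ (by positivity),
          ENNReal.ofReal_one]
      _ ≤ _ := ENNReal.ofReal_le_ofReal (by
        have := Real.add_one_le_exp (-z ^ (d - 1))
        linarith)

/-- The expected squared sine of the quantization angle for a random codebook of size `n`. -/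
theorem lintegral_quantization_error_le {d n : ℕ} (hd : 2 ≤ d) (hn : 0 < n)
    {ν : Fin n → Measure (CVec d)} (hν : ∀ i, IsUniformOnSphere (ν i))
    {u : CVec d} (hu : ‖u‖ = 1) {r : (Fin n → CVec d) → ℝ} (hr : Measurable r)
    (hr0 : ∀ᵐ C ∂Measure.pi ν, 0 ≤ r C) (hr1 : ∀ C i, r C ≤ 1 - ‖⟪u, C i⟫_ℂ‖ ^ 2) :
    ∫⁻ C, ENNReal.ofReal (r C) ∂Measure.pi ν
      ≤ ENNReal.ofReal ((n : ℝ) ^ (-1 / ((d : ℝ) - 1)) * Real.Gamma (1 / ((d : ℝ) - 1) + 1)) := by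
  have hprob : ∀ i, IsProbabilityMeasure (ν i) := fun i => (hν i).isProbabilityMeasure
  have hd' : (0 : ℝ) < (d : ℝ) - 1 := by
    have : (2 : ℝ) ≤ d := by exact_mod_cast hd
    linarith
  have hn' : (0 : ℝ) < n := by exact_mod_cast hn
  -- Layer cake: the mean is the integral of the tail. Below, `r C > t` forces the error of every
  -- codeword above `t`, and independence turns this into a product of `n` tails.
  rw [lintegral_eq_lintegral_meas_lt _ hr0 hr.aemeasurable, ← integral_exp_neg_mul_rpow hd' hn',
    ofReal_integral_eq_lintegral_ofReal]
  · refine setLIntegral_mono' measurableSet_Ioi fun t ht => ?_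
    have ht' : (0 : ℝ) < t := ht
    calc Measure.pi ν {C | t < r C}
        ≤ Measure.pi ν (Set.univ.pi fun _ => {c | t < 1 - ‖⟪u, c⟫_ℂ‖ ^ 2}) :=
          measure_mono fun C hC i _ => lt_of_lt_of_le hC (hr1 C i)
      _ = ∏ i, ν i {c | t < 1 - ‖⟪u, c⟫_ℂ‖ ^ 2} := Measure.pi_pi _ _
      _ ≤ ∏ _i : Fin n, ENNReal.ofReal (Real.exp (-t ^ (d - 1))) :=
          Finset.prod_le_prod' fun i _ => (hν i).measure_lt_sin_sq_le hu ht'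
      _ = ENNReal.ofReal (Real.exp (-n * t ^ ((d : ℝ) - 1))) := by
          rw [Finset.prod_const, Finset.card_univ, Fintype.card_fin,
            ← ENNReal.ofReal_pow (Real.exp_pos _).le, ← Real.exp_nat_mul, ← Real.rpow_natCast,
            Nat.cast_sub (by omega), Nat.cast_one]
          ring_nf
  -- The integral of a non-integrable function is `0` by convention, whereas the closed form is
  -- positive.
  · by_contra h
    have := integral_exp_neg_mul_rpow hd' hn'
    rw [integral_undef h] at this
    have h1 : 0 < (n : ℝ) ^ (-1 / ((d : ℝ) - 1)) := Real.rpow_pos_of_pos hn' _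
    have h2 : 0 < Real.Gamma (1 / ((d : ℝ) - 1) + 1) := Real.Gamma_pos_of_pos (by positivity)
    exact absurd this (mul_pos h1 h2).ne
  · exact Filter.Eventually.of_forall fun _ => (Real.exp_pos _).le

/-! ### Averaging over the unitary group -/

/-- The unitary group of `ℂ^d`. -/
abbrev UGroup (d : ℕ) : Type := unitary (CVec d →L[ℂ] CVec d)

instance (d : ℕ) : ContinuousStar (CVec d →L[ℂ] CVec d) :=
  ⟨(ContinuousLinearMap.adjoint (𝕜 := ℂ) (E := CVec d) (F := CVec d)).continuous⟩

/-- Compactness allows the Haar measure to be normalized to total mass one. -/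
instance (d : ℕ) : CompactSpace (UGroup d) := by
  have hc : IsCompact (unitary (CVec d →L[ℂ] CVec d) : Set (CVec d →L[ℂ] CVec d)) := by
    refine Metric.isCompact_of_isClosed_isBounded isClosed_unitary ?_
    refine (Metric.isBounded_closedBall (x := 0) (r := 1)).subset fun U hU => ?_
    rw [mem_closedBall_zero_iff]
    refine ContinuousLinearMap.opNorm_le_bound _ zero_le_one fun x => ?_
    have := (Unitary.linearIsometryEquiv ⟨U, hU⟩).norm_map x
    rw [one_mul]
    exact this.le
  exact isCompact_iff_compactSpace.1 hc

theorem UGroup.inner_map_map {d : ℕ} (U : UGroup d) (x y : CVec d) :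
    ⟪(U : CVec d →L[ℂ] CVec d) x, (U : CVec d →L[ℂ] CVec d) y⟫_ℂ = ⟪x, y⟫_ℂ :=
  (Unitary.linearIsometryEquiv U).inner_map_map x y

theorem UGroup.norm_map {d : ℕ} (U : UGroup d) (x : CVec d) :
    ‖(U : CVec d →L[ℂ] CVec d) x‖ = ‖x‖ :=
  (Unitary.linearIsometryEquiv U).norm_map x

theorem UGroup.measurable_apply {d : ℕ} :
    Measurable fun p : UGroup d × CVec d => (p.1 : CVec d →L[ℂ] CVec d) p.2 := by
  have : Continuous fun p : UGroup d × CVec d => (p.1 : CVec d →L[ℂ] CVec d) p.2 :=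
    (continuous_subtype_val.comp continuous_fst).clm_apply continuous_snd
  exact this.measurable

/-- Inversion turns left invariance of Haar measure into right invariance. The right side is the one
needed, since an element that fixes `q` has to act before the random rotation. -/
theorem exists_right_invariant_measure (d : ℕ) :
    ∃ ρ : Measure (UGroup d), IsProbabilityMeasure ρ ∧ ∀ g, ρ.map (· * g) = ρ := by
  let ρ₀ : Measure (UGroup d) := Measure.haarMeasure ⊤
  have h1 : IsProbabilityMeasure ρ₀ := ⟨Measure.haarMeasure_self (K₀ := ⊤)⟩
  have h2 : ρ₀.IsMulLeftInvariant := inferInstance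
  refine ⟨ρ₀.inv, Measure.isProbabilityMeasure_map measurable_inv.aemeasurable, fun g => ?_⟩
  exact map_mul_right_eq_self ρ₀.inv g

/-- Let `J e` be the mean of `|⟪W(Uq), Ue⟫|²`. By symmetry `J` is constant on unit vectors
orthogonal to `q`. By Parseval its values on an orthonormal basis of that complement sum to `1`, as
`W(Uq)` is a unit vector orthogonal to `Uq`. So the constant is `1/(d - 1)`, and only the part of
`h` orthogonal to `q` counts. -/
theorem lintegral_unitary_inner_sq {d : ℕ} (hd : 2 ≤ d) {ρ : Measure (UGroup d)}
    [IsProbabilityMeasure ρ] (hρ : ∀ g, ρ.map (· * g) = ρ) {q : CVec d} (hq : ‖q‖ = 1)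
    (h : CVec d) {W : CVec d → CVec d} (hW : Measurable W)
    (hW1 : ∀ᵐ U : UGroup d ∂ρ, ‖W ((U : CVec d →L[ℂ] CVec d) q)‖ = 1 ∧
      ⟪W ((U : CVec d →L[ℂ] CVec d) q), (U : CVec d →L[ℂ] CVec d) q⟫_ℂ = 0) :
    ∫⁻ U, ENNReal.ofReal (‖⟪W ((U : CVec d →L[ℂ] CVec d) q),
        (U : CVec d →L[ℂ] CVec d) h⟫_ℂ‖ ^ 2) ∂ρ
      = ENNReal.ofReal ((‖h‖ ^ 2 - ‖⟪q, h⟫_ℂ‖ ^ 2) / ((d : ℝ) - 1)) := by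
  have happ : ∀ x : CVec d, Measurable fun U : UGroup d => (U : CVec d →L[ℂ] CVec d) x := fun x =>
    UGroup.measurable_apply.comp (measurable_id.prodMk measurable_const)
  let J : CVec d → ENNReal := fun e => ∫⁻ U, ENNReal.ofReal
    (‖⟪W ((U : CVec d →L[ℂ] CVec d) q), (U : CVec d →L[ℂ] CVec d) e⟫_ℂ‖ ^ 2) ∂ρ
  have hmeas : ∀ e : CVec d, Measurable fun U : UGroup d => ENNReal.ofReal
      (‖⟪W ((U : CVec d →L[ℂ] CVec d) q), (U : CVec d →L[ℂ] CVec d) e⟫_ℂ‖ ^ 2) := fun e =>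
    (((hW.comp (happ q)).inner (happ e)).norm.pow_const 2).ennreal_ofReal
  have hJeq : ∀ e e' : CVec d, ‖e‖ = 1 → ‖e'‖ = 1 → ⟪q, e⟫_ℂ = 0 → ⟪q, e'⟫_ℂ = 0 →
      J e' = J e := by
    intro e e' he he' hqe hqe'
    -- The substitution `U ↦ U V` leaves `W(Uq)` alone, because `V q = q`, and turns `U e` into `U
    -- e'`.
    obtain ⟨V, hVq, hVe⟩ := exists_isometry_fix_map_eq hq he he' hqe hqe'
    let g : UGroup d := Unitary.linearIsometryEquiv.symm V
    have hg : ∀ x, (g : CVec d →L[ℂ] CVec d) x = V x := fun x => rfl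
    have hmul : ∀ (U : UGroup d) (x : CVec d), ((U * g : UGroup d) : CVec d →L[ℂ] CVec d) x
        = (U : CVec d →L[ℂ] CVec d) (V x) := fun U x => rfl
    have : J e = ∫⁻ U, ENNReal.ofReal (‖⟪W ((U : CVec d →L[ℂ] CVec d) q),
        (U : CVec d →L[ℂ] CVec d) e⟫_ℂ‖ ^ 2) ∂(ρ.map (· * g)) := by rw [hρ]
    rw [this, lintegral_map (hmeas e) (measurable_mul_const g)]
    simp only [hmul, hVq, hVe, J]
  have hJ : ∀ e : CVec d, ‖e‖ = 1 → ⟪q, e⟫_ℂ = 0 → J e = ENNReal.ofReal (1 / ((d : ℝ) - 1)) := by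
    intro e he hqe
    obtain ⟨V, hV⟩ := exists_isometry_map_eq
      (x := EuclideanSpace.single (⟨0, by omega⟩ : Fin d) (1 : ℂ)) (by simp) hq
    let b := (EuclideanSpace.basisFun (Fin d) ℂ).map V
    have hb0 : b ⟨0, by omega⟩ = q := by simp [b, hV]
    -- Parseval in the rotated basis `U b_i`; the omitted term, at `U q`, is zero.
    have hsum : ∑ i ∈ Finset.univ.erase (⟨0, by omega⟩ : Fin d), J (b i) = 1 := by
      rw [← lintegral_finsetSum _ fun i _ => hmeas _]
      have : ∀ᵐ U : UGroup d ∂ρ, ∑ i ∈ Finset.univ.erase (⟨0, by omega⟩ : Fin d), ENNReal.ofReal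
          (‖⟪W ((U : CVec d →L[ℂ] CVec d) q), (U : CVec d →L[ℂ] CVec d) (b i)⟫_ℂ‖ ^ 2) = 1 := by
        filter_upwards [hW1] with U hU
        have h1 := (b.map (Unitary.linearIsometryEquiv U)).sum_sq_norm_inner_left
          (W ((U : CVec d →L[ℂ] CVec d) q))
        have h2 : ∀ i, b.map (Unitary.linearIsometryEquiv U) i
          = (U : CVec d →L[ℂ] CVec d) (b i) := fun i => b.map_apply _ i
        simp only [h2] at h1
        rw [← Finset.add_sum_erase _ _ (Finset.mem_univ (⟨0, by omega⟩ : Fin d)), hb0, hU.2,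
          hU.1] at h1
        rw [← ENNReal.ofReal_sum_of_nonneg fun _ _ => by positivity, ← ENNReal.ofReal_one]
        congr 1
        simpa using h1
      rw [lintegral_congr_ae this]
      simp
    have hall : ∀ i ∈ Finset.univ.erase (⟨0, by omega⟩ : Fin d), J (b i) = J e := fun i hi =>
      hJeq _ _ he (b.orthonormal.1 i) hqe (by
        rw [← hb0]; exact b.orthonormal.2 (Finset.ne_of_mem_erase hi).symm)
    rw [Finset.sum_congr rfl hall, Finset.sum_const, Finset.card_erase_of_mem (Finset.mem_univ _),
      Finset.card_univ, Fintype.card_fin, nsmul_eq_mul, mul_comm] at hsum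
    rw [one_div, ENNReal.ofReal_inv_of_pos (by
      have : (2 : ℝ) ≤ d := by exact_mod_cast hd
      linarith)]
    rw [ENNReal.eq_inv_of_mul_eq_one_left hsum]
    congr 1
    rw [← ENNReal.ofReal_natCast, Nat.cast_sub (by omega), Nat.cast_one]
  set r : CVec d := h - ⟪q, h⟫_ℂ • q with hr
  have hqq : ⟪q, q⟫_ℂ = 1 := by rw [inner_self_eq_norm_sq_to_K, hq]; simp
  have hqr : ⟪q, r⟫_ℂ = 0 := by
    rw [hr, inner_sub_right, inner_smul_right, hqq, mul_one, sub_self]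
  have hnorm : ‖r‖ ^ 2 = ‖h‖ ^ 2 - ‖⟪q, h⟫_ℂ‖ ^ 2 := by
    have h1 : h = ⟪q, h⟫_ℂ • q + r := by rw [hr]; abel
    have h2 := norm_add_sq_eq_norm_sq_add_norm_sq_of_inner_eq_zero (𝕜 := ℂ) (⟪q, h⟫_ℂ • q) r
      (by rw [inner_smul_left, hqr, mul_zero])
    rw [← h1, norm_smul, hq, mul_one] at h2
    nlinarith
  have hJr : J h = J r := by
    refine lintegral_congr_ae ?_
    filter_upwards [hW1] with U hU
    rw [hr, map_sub, map_smul, inner_sub_right, inner_smul_right, hU.2, mul_zero, sub_zero]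
  change J h = _
  rw [hJr, ← hnorm]
  by_cases hr0 : r = 0
  · simp [hr0, J]
  have hrpos : 0 < ‖r‖ := norm_pos_iff.2 hr0
  let e : CVec d := ((‖r‖⁻¹ : ℝ) : ℂ) • r
  have hre : r = ((‖r‖ : ℝ) : ℂ) • e := by
    simp only [e]
    rw [smul_smul, ← Complex.ofReal_mul, mul_inv_cancel₀ hrpos.ne', Complex.ofReal_one, one_smul]
  have he : ‖e‖ = 1 := by
    simp only [e]
    rw [norm_smul, Complex.norm_real, norm_inv, norm_norm, inv_mul_cancel₀ hrpos.ne']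
  have hqe : ⟪q, e⟫_ℂ = 0 := by simp only [e]; rw [inner_smul_right, hqr, mul_zero]
  have hscale : J r = ENNReal.ofReal (‖r‖ ^ 2) * J e := by
    have hpt : ∀ U : UGroup d, ENNReal.ofReal
        (‖⟪W ((U : CVec d →L[ℂ] CVec d) q), (U : CVec d →L[ℂ] CVec d) r⟫_ℂ‖ ^ 2)
        = ENNReal.ofReal (‖r‖ ^ 2) * ENNReal.ofReal
        (‖⟪W ((U : CVec d →L[ℂ] CVec d) q), (U : CVec d →L[ℂ] CVec d) e⟫_ℂ‖ ^ 2) := by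
      intro U
      conv_lhs => rw [hre]
      rw [map_smul, inner_smul_right, norm_mul, Complex.norm_real, norm_norm, mul_pow,
        ENNReal.ofReal_mul (by positivity)]
    simp only [J, hpt]
    rw [lintegral_const_mul _ (hmeas e)]
  rw [hscale, hJ e he hqe, ← ENNReal.ofReal_mul (by positivity), mul_one_div]

/-! ### Quantization -/

theorem norm_direction {d : ℕ} {x : CVec d} (hx : x ≠ 0) : ‖direction x‖ = 1 := by
  rw [direction, norm_smul, Complex.norm_real, norm_inv, norm_norm,
    inv_mul_cancel₀ (norm_ne_zero_iff.2 hx)]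

theorem norm_smul_direction {d : ℕ} (x : CVec d) : ((‖x‖ : ℝ) : ℂ) • direction x = x := by
  rcases eq_or_ne x 0 with rfl | hx
  · simp [direction]
  · rw [direction, smul_smul, ← Complex.ofReal_mul, mul_inv_cancel₀ (norm_ne_zero_iff.2 hx),
      Complex.ofReal_one, one_smul]

theorem direction_map {d : ℕ} (U : CVec d ≃ₗᵢ[ℂ] CVec d) (x : CVec d) :
    direction (U x) = U (direction x) := by
  rw [direction, direction, U.norm_map, U.map_smul]

theorem measurable_direction {d : ℕ} : Measurable (direction : CVec d → CVec d) := by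
  unfold direction
  fun_prop

section Quantize

variable {d b : ℕ}

theorem mem_maximizers {C : Fin (2 ^ b) → CVec d} {u : CVec d} {i : Fin (2 ^ b)} :
    i ∈ maximizers C u ↔ ∀ j, ‖⟪C j, u⟫_ℂ‖ ≤ ‖⟪C i, u⟫_ℂ‖ := by
  rw [maximizers, Finset.mem_filter]
  exact ⟨fun h => h.2, fun h => ⟨Finset.mem_univ _, h⟩⟩

theorem maximizers_map (U : CVec d ≃ₗᵢ[ℂ] CVec d) (C : Fin (2 ^ b) → CVec d) (u : CVec d) :
    maximizers (fun i => U (C i)) (U u) = maximizers C u := by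
  ext i
  simp only [mem_maximizers, U.inner_map_map]

/-- A common rotation changes none of the moduli that are compared, so the same index is selected,
ties included. -/
theorem quantize_map (U : CVec d ≃ₗᵢ[ℂ] CVec d) (C : Fin (2 ^ b) → CVec d) (u : CVec d) :
    quantize (fun i => U (C i)) (U u) = U (quantize C u) := by
  simp only [quantize, maximizers_map]

theorem exists_quantize_eq (C : Fin (2 ^ b) → CVec d) (u : CVec d) : ∃ i, quantize C u = C i :=
  ⟨_, rfl⟩

theorem norm_inner_le_quantize (C : Fin (2 ^ b) → CVec d) (u : CVec d) (i : Fin (2 ^ b)) :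
    ‖⟪u, C i⟫_ℂ‖ ≤ ‖⟪u, quantize C u⟫_ℂ‖ := by
  have h := (maximizers C u).min'_mem (maximizers_nonempty C u)
  rw [norm_inner_symm u, norm_inner_symm u]
  exact mem_maximizers.1 h i

theorem measurable_quantize :
    Measurable fun p : (Fin (2 ^ b) → CVec d) × CVec d => quantize p.1 p.2 := by
  let idx : (Fin (2 ^ b) → CVec d) × CVec d → Fin (2 ^ b) := fun p =>
    (maximizers p.1 p.2).min' (maximizers_nonempty p.1 p.2)
  have hmem : ∀ i : Fin (2 ^ b), MeasurableSet
      {p : (Fin (2 ^ b) → CVec d) × CVec d | i ∈ maximizers p.1 p.2} := by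
    intro i
    have : {p : (Fin (2 ^ b) → CVec d) × CVec d | i ∈ maximizers p.1 p.2}
        = ⋂ j, {p | ‖⟪p.1 j, p.2⟫_ℂ‖ ≤ ‖⟪p.1 i, p.2⟫_ℂ‖} := by
      ext p
      simp [mem_maximizers]
    rw [this]
    refine MeasurableSet.iInter fun j => ?_
    have hj : ∀ j : Fin (2 ^ b), Measurable fun p : (Fin (2 ^ b) → CVec d) × CVec d => p.1 j :=
      fun j => (measurable_pi_apply j).comp measurable_fst
    exact measurableSet_le ((hj j).inner measurable_snd).norm ((hj i).inner measurable_snd).norm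
  have hidx : Measurable idx := by
    refine measurable_to_countable' fun i => ?_
    have : idx ⁻¹' {i} = {p | i ∈ maximizers p.1 p.2} ∩
        ⋂ j : {j : Fin (2 ^ b) // j < i}, {p | j.1 ∈ maximizers p.1 p.2}ᶜ := by
      ext p
      simp only [Set.mem_preimage, Set.mem_singleton_iff, Set.mem_inter_iff, Set.mem_ofPred_eq,
        Set.mem_iInter, Set.mem_compl_iff, idx]
      constructor
      · rintro rfl
        exact ⟨Finset.min'_mem _ _, fun j hj => absurd (Finset.min'_le _ _ hj) (not_le.2 j.2)⟩
      · rintro ⟨h1, h2⟩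
        refine le_antisymm (Finset.min'_le _ _ h1) (not_lt.1 fun hlt => ?_)
        exact h2 ⟨_, hlt⟩ (Finset.min'_mem _ (maximizers_nonempty p.1 p.2))
    rw [this]
    exact (hmem i).inter (MeasurableSet.iInter fun j => (hmem j).compl)
  have heval : Measurable fun q : Fin (2 ^ b) × ((Fin (2 ^ b) → CVec d) × CVec d) => q.2.1 q.1 :=
    measurable_from_prod_countable_right fun i =>
      (measurable_pi_apply i).comp (measurable_fst (β := CVec d))
  exact heval.comp (hidx.prodMk measurable_id)

end Quantize

/-! ### Product measures -/

section Product

variable {ι : Type*} [Fintype ι]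

theorem ae_eval_pi {E : Type*} [MeasurableSpace E] {ν : ι → Measure E}
    [∀ i, IsProbabilityMeasure (ν i)] (c : ι) {P : E → Prop} (h : ∀ᵐ v ∂ν c, P v) :
    ∀ᵐ x ∂Measure.pi ν, P (x c) :=
  (measurePreserving_eval ν c).quasiMeasurePreserving.ae h

/-- A coordinate and a group of other coordinates of a product measure are independent. -/
theorem lintegral_pi_marginal {E κ : Type*} [Fintype κ] [MeasurableSpace E]
    {ν : ι → Measure E} [∀ i, IsProbabilityMeasure (ν i)] {g : Option κ → ι}
    (hg : Function.Injective g) {f : E → (κ → E) → ENNReal}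
    (hf : Measurable (Function.uncurry f)) :
    ∫⁻ x, f (x (g none)) (fun i => x (g (some i))) ∂Measure.pi ν
      = ∫⁻ v, ∫⁻ C, f v C ∂Measure.pi (fun i => ν (g (some i))) ∂ν (g none) := by
  have hmap : (Measure.pi ν).map (fun x o => x (g o)) = Measure.pi fun o => ν (g o) := by
    have h1 : iIndepFun (fun c (x : ι → E) => x c) (Measure.pi ν) :=
      iIndepFun_pi (X := fun _ v => v) fun _ => aemeasurable_id
    have h2 := (h1.precomp hg).map_fun_eq_pi_map fun o => (measurable_pi_apply _).aemeasurable
    rw [h2]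
    congr 1
    funext o
    exact (measurePreserving_eval ν (g o)).map_eq
  have hopt : ((ν (g none)).prod (Measure.pi fun i => ν (g (some i)))).map
      (fun (p : E × (κ → E)) (o : Option κ) => o.elim p.1 p.2) = Measure.pi fun o => ν (g o) := by
    refine (Measure.pi_eq fun s hs => ?_).symm
    have hm : Measurable fun (p : E × (κ → E)) (o : Option κ) => o.elim p.1 p.2 := by
      refine measurable_pi_lambda _ fun o => ?_
      cases o
      · exact measurable_fst
      · exact (measurable_pi_apply _).comp measurable_snd
    have hpre : (fun (p : E × (κ → E)) (o : Option κ) => o.elim p.1 p.2) ⁻¹' Set.univ.pi s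
        = s none ×ˢ Set.univ.pi fun i => s (some i) := by
      ext p
      simp only [Set.mem_preimage, Set.mem_pi, Set.mem_univ, true_implies, Set.mem_prod]
      exact Option.forall
    rw [Measure.map_apply hm (MeasurableSet.univ_pi hs), hpre, Measure.prod_prod, Measure.pi_pi,
      Fintype.prod_option]
  have hfm : Measurable fun y : Option κ → E => f (y none) fun i => y (some i) :=
    hf.comp (f := fun y : Option κ → E => (y none, fun i => y (some i)))
      ((measurable_pi_apply none).prodMk
      (measurable_pi_lambda _ fun i => measurable_pi_apply (some i)))
  have hm : Measurable fun (p : E × (κ → E)) (o : Option κ) => o.elim p.1 p.2 := by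
    refine measurable_pi_lambda _ fun o => ?_
    cases o
    · exact measurable_fst
    · exact (measurable_pi_apply _).comp measurable_snd
  calc ∫⁻ x, f (x (g none)) (fun i => x (g (some i))) ∂Measure.pi ν
      = ∫⁻ y, f (y none) (fun i => y (some i)) ∂((Measure.pi ν).map fun x o => x (g o)) :=
        (lintegral_map (g := fun (x : ι → E) o => x (g o)) hfm
          (measurable_pi_lambda _ fun o => measurable_pi_apply _)).symm
    _ = ∫⁻ p, f p.1 p.2 ∂((ν (g none)).prod (Measure.pi fun i => ν (g (some i)))) := by
        rw [hmap, ← hopt, lintegral_map hfm hm]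
        rfl
    _ = _ := lintegral_prod (fun p : E × (κ → E) => f p.1 p.2) hf.aemeasurable

theorem exists_unit_orthogonal {d : ℕ} (S : Submodule ℂ (CVec d)) (hS : Module.finrank ℂ S < d) :
    ∃ a : CVec d, ‖a‖ = 1 ∧ ∀ x ∈ S, ⟪a, x⟫_ℂ = 0 := by
  have hne : Sᗮ ≠ ⊥ := by
    intro h
    have := S.finrank_add_finrank_orthogonal
    rw [h, finrank_bot, finrank_euclideanSpace_fin] at this
    omega
  obtain ⟨a, ha, ha0⟩ := Submodule.exists_mem_ne_zero_of_ne_bot hne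
  refine ⟨direction a, norm_direction ha0, fun x hx => ?_⟩
  rw [direction, inner_smul_left, (Submodule.mem_orthogonal' S a).1 ha x hx, mul_zero]

/-- Few independent isotropic vectors are almost surely linearly independent. -/
theorem ae_linearIndepOn [DecidableEq ι] {d : ℕ} {ν : ι → Measure (CVec d)}
    [∀ i, IsProbabilityMeasure (ν i)] (s : Finset ι) (hν : ∀ i ∈ s, IsUniformOnSphere (ν i))
    (hs : s.card ≤ d) : ∀ᵐ x ∂Measure.pi ν, LinearIndepOn ℂ x (s : Set ι) := by
  have hmeas : ∀ t : Finset ι, MeasurableSet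
      {x : ι → CVec d | LinearIndepOn ℂ x (t : Set ι)} := by
    intro t
    have ho : IsOpen {f : ↑(t : Set ι) → CVec d | LinearIndependent ℂ f} :=
      isOpen_setOfPred_linearIndependent
    have hr : Measurable fun (x : ι → CVec d) (c : (t : Set ι)) => x c :=
      measurable_pi_lambda _ fun c => measurable_pi_apply _
    have hS : MeasurableSet {f : ↑(t : Set ι) → CVec d | LinearIndependent ℂ f} := ho.measurableSet
    exact hr hS
  induction s using Finset.induction_on with
  | empty => simp
  | insert a s ha ih =>
    have hcard : s.card < d := by rw [Finset.card_insert_of_notMem ha] at hs; omega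
    have ih' := ih (fun i hi => hν i (Finset.mem_insert_of_mem hi)) hcard.le
    let bad : Set (ι → CVec d) := {x | LinearIndepOn ℂ x (s : Set ι)} \
      {x | LinearIndepOn ℂ x ((insert a s : Finset ι) : Set ι)}
    have hbad : MeasurableSet bad := (hmeas _).diff (hmeas _)
    have hzero : Measure.pi ν bad = 0 := by
      rw [← lintegral_indicator_one hbad,
        lintegral_pi_update ν a (measurable_one.indicator hbad)]
      refine (lintegral_congr fun x => ?_).trans lintegral_zero
      -- Only the coordinate `a` is resampled, so `u` is fixed for the inner integral. A new vector
      -- in the span of the others would be orthogonal to `u`, which has probability zero.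
      obtain ⟨u, hu, hperp⟩ := exists_unit_orthogonal (Submodule.span ℂ (x '' (s : Set ι))) (by
        rw [← Finset.coe_image]
        exact ((finrank_span_finset_le_card _).trans Finset.card_image_le).trans_lt hcard)
      have h0 := (hν a (Finset.mem_insert_self _ _)).ae_inner_ne_zero hu
      refine (lintegral_congr_ae (g := 0) ?_).trans lintegral_zero
      filter_upwards [h0] with v hv
      rw [Pi.zero_apply, Set.indicator_of_notMem]
      rintro ⟨h1, h2⟩
      apply h2
      have himg : Function.update x a v '' (s : Set ι) = x '' (s : Set ι) :=
        Set.image_congr fun i hi => Function.update_of_ne (by rintro rfl; exact ha hi) _ _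
      change LinearIndepOn ℂ (Function.update x a v) ((insert a s : Finset ι) : Set ι)
      rw [Finset.coe_insert, linearIndepOn_insert (by simpa using ha), himg,
        Function.update_self]
      exact ⟨h1, fun hmem => hv (hperp _ hmem)⟩
    have hb : ∀ᵐ x ∂Measure.pi ν, x ∉ bad := measure_eq_zero_iff_ae_notMem.1 hzero
    filter_upwards [ih', hb] with x h1 h2
    by_contra h3
    exact h2 ⟨h1, h3⟩

end Product

/-! ### Beamformers as functions of channels and codewords -/

section Beam

variable {M N K : ℕ}

theorem card_otherUsers (n : Fin N) :
    Fintype.card ({m : Fin N // m ≠ n} × Fin K) = (N - 1) * K := by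
  rw [Fintype.card_prod, Fintype.card_fin, Fintype.card_subtype_compl, Fintype.card_fin,
    Fintype.card_subtype_eq]

/-- The conjugate of the zero-forcing beamformer for the quantized directions `Q` of the users
outside cluster `n` and the coefficients `p`. -/
def zfBeam (F : NullBasis M N K) (n : Fin N) (Q : {m : Fin N // m ≠ n} × Fin K → CVec M)
    (p : CVec (M - (N - 1) * K)) : CVec M :=
  conjVec ((F.V n (Matrix.of fun u => (Q u).ofLp)).mulVec p.ofLp)

theorem measurable_zfBeam (F : NullBasis M N K) (n : Fin N) :
    Measurable fun z : ({m : Fin N // m ≠ n} × Fin K → CVec M) × CVec (M - (N - 1) * K) =>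
      zfBeam F n z.1 z.2 := by
  refine measurable_conjVec.comp (measurable_pi_lambda _ fun i => ?_)
  simp only [Matrix.mulVec, dotProduct]
  refine Finset.measurable_sum _ fun j _ => ?_
  have h1 : Measurable fun z : ({m : Fin N // m ≠ n} × Fin K → CVec M) × CVec (M - (N - 1) * K) =>
      F.V n (Matrix.of fun u => (z.1 u).ofLp) i j := by
    refine (F.measurable_entry n i j).comp (measurable_pi_lambda _ fun u => ?_)
    exact (PiLp.continuous_ofLp 2 _).measurable.comp
      ((measurable_pi_apply u).comp measurable_fst)
  have h2 : Measurable fun z : ({m : Fin N // m ≠ n} × Fin K → CVec M) × CVec (M - (N - 1) * K) =>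
      z.2.ofLp j := by fun_prop
  exact h1.mul h2

theorem norm_conjVec_sq {d : ℕ} (w : Fin d → ℂ) : ((‖conjVec w‖ ^ 2 : ℝ) : ℂ) = star w ⬝ᵥ w := by
  rw [EuclideanSpace.norm_sq_eq]
  simp only [dotProduct, conjVec, Pi.star_apply, RCLike.star_def, RCLike.norm_conj]
  push_cast
  exact Finset.sum_congr rfl fun i _ => (Complex.conj_mul' _).symm

/-- Linear independence of the rows is full row rank, the case in which `F` is constrained:
orthonormal columns preserve the norm of `p`, and the null space property gives the orthogonality.
-/
theorem zfBeam_spec (F : NullBasis M N K) (n : Fin N)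
    {Q : {m : Fin N // m ≠ n} × Fin K → CVec M} (hQ : LinearIndependent ℂ Q)
    {p : CVec (M - (N - 1) * K)} (hp : ‖p‖ = 1) :
    ‖zfBeam F n Q p‖ = 1 ∧ ∀ u, ⟪zfBeam F n Q p, Q u⟫_ℂ = 0 := by
  set H : Matrix ({m : Fin N // m ≠ n} × Fin K) (Fin M) ℂ := Matrix.of fun u => (Q u).ofLp with hH
  have hrow : LinearIndependent ℂ H.row :=
    hQ.map' (WithLp.linearEquiv 2 ℂ (Fin M → ℂ)).toLinearMap (LinearEquiv.ker _)
  have hrank : H.rank = (N - 1) * K := by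
    rw [hrow.rank_matrix, card_otherUsers]
  constructor
  · have h1 : ((‖zfBeam F n Q p‖ ^ 2 : ℝ) : ℂ) = 1 := by
      rw [zfBeam, norm_conjVec_sq, Matrix.star_mulVec, Matrix.dotProduct_mulVec,
        Matrix.vecMul_vecMul, F.orthonormal n H hrank, Matrix.vecMul_one]
      have h2 : ‖conjVec p.ofLp‖ = ‖p‖ := by
        simp [EuclideanSpace.norm_eq, conjVec]
      rw [← norm_conjVec_sq, h2, hp]
      simp
    have h3 : ‖zfBeam F n Q p‖ ^ 2 = 1 := by exact_mod_cast h1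
    exact (pow_eq_one_iff_of_nonneg (norm_nonneg _) two_ne_zero).1 h3
  · intro u
    rw [zfBeam, ← rowMul_eq_inner]
    have h1 : (H.mulVec ((F.V n H).mulVec p.ofLp)) u = 0 := by
      rw [Matrix.mulVec_mulVec, F.mul_eq_zero n H hrank, Matrix.zero_mulVec, Pi.zero_apply]
    exact h1

end Beam

/-! ### The law of all channels and codewords -/

section Law

variable {M N K : ℕ} (sys : System M N K)

/-- The index set of all channels and codewords. -/
abbrev Idx : Type := (Fin N × Fin K) ⊕ ((u : Fin N × Fin K) × Fin (2 ^ sys.bits u.1 u.2))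

variable {sys}

/-- The quantized direction of user `u`. -/
noncomputable def famHat (x : Idx sys → CVec M) (u : Fin N × Fin K) : CVec M :=
  quantize (fun i => x (Sum.inr ⟨u, i⟩)) (direction (x (Sum.inl u)))

/-- The quantized directions of the users outside cluster `n`. -/
noncomputable def otherHat (n : Fin N) (x : Idx sys → CVec M)
    (t : {m : Fin N // m ≠ n} × Fin K) : CVec M :=
  famHat x (t.1.1, t.2)

theorem measurable_famHat (u : Fin N × Fin K) :
    Measurable fun x : Idx sys → CVec M => famHat x u :=
  measurable_quantize.comp (f := fun x : Idx sys → CVec M =>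
      (fun i => x (Sum.inr ⟨u, i⟩), direction (x (Sum.inl u))))
    ((measurable_pi_lambda _ fun _ => measurable_pi_apply _).prodMk
      (measurable_direction.comp (measurable_pi_apply _)))

theorem measurable_otherHat (n : Fin N) :
    Measurable fun x : Idx sys → CVec M => otherHat n x :=
  measurable_pi_lambda _ fun _ => measurable_famHat _

/-- Rayleigh fading and isotropic codewords. -/
structure IsLawFamily (ν : Idx sys → Measure (CVec M)) : Prop where
  channel : ∀ u, ν (Sum.inl u) = rayleighLaw M
  codeword : ∀ c, IsUniformOnSphere (ν (Sum.inr c))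

namespace IsLawFamily

variable {ν : Idx sys → Measure (CVec M)} (hν : IsLawFamily ν)

include hν

theorem isProbabilityMeasure (c : Idx sys) : IsProbabilityMeasure (ν c) := by
  rcases c with u | c
  · rw [hν.channel]; infer_instance
  · exact (hν.codeword c).isProbabilityMeasure

theorem map_unitary (c : Idx sys) (U : CVec M ≃ₗᵢ[ℂ] CVec M) : (ν c).map U = ν c := by
  rcases c with u | c
  · rw [hν.channel]; exact rayleighLaw_map_unitary U
  · exact (hν.codeword c).map_unitary U

theorem ae_norm_codeword : ∀ᵐ x ∂Measure.pi ν, ∀ c, ‖x (Sum.inr c)‖ = 1 := by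
  have := hν.isProbabilityMeasure
  exact ae_all_iff.2 fun c => ae_eval_pi (ν := ν) (Sum.inr c) (hν.codeword c).norm_eq_one

/-- The selected codewords depend on the channels, so they are not simply independent isotropic
vectors. There are, however, finitely many selections `s`, and for each fixed one `ae_linearIndepOn`
applies; almost surely all of them are independent, hence also the actual one. -/
theorem ae_linearIndependent (hZF : (N - 1) * K < M) (n : Fin N) :
    ∀ᵐ x ∂Measure.pi ν, LinearIndependent ℂ (otherHat n x) := by
  have := hν.isProbabilityMeasure
  let e : ((u : Fin N × Fin K) → Fin (2 ^ sys.bits u.1 u.2)) →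
      {m : Fin N // m ≠ n} × Fin K → Idx sys :=
    fun s t => Sum.inr ⟨(t.1.1, t.2), s (t.1.1, t.2)⟩
  have hall : ∀ᵐ x ∂Measure.pi ν, ∀ s,
      LinearIndepOn ℂ x ((Finset.univ.image (e s) : Finset (Idx sys)) : Set (Idx sys)) := by
    refine ae_all_iff.2 fun s => ae_linearIndepOn _ ?_ ?_
    · intro i hi
      obtain ⟨t, -, rfl⟩ := Finset.mem_image.1 hi
      exact hν.codeword _
    · refine Finset.card_image_le.trans ?_
      rw [Finset.card_univ, card_otherUsers]
      exact hZF.le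
  filter_upwards [hall] with x hx
  choose s hs using fun u : Fin N × Fin K =>
    exists_quantize_eq (fun i => x (Sum.inr ⟨u, i⟩)) (direction (x (Sum.inl u)))
  have hli : LinearIndependent ℂ fun c :
      ((Finset.univ.image (e s) : Finset (Idx sys)) : Set (Idx sys)) => x c := hx s
  have hinj : Function.Injective fun t : {m : Fin N // m ≠ n} × Fin K =>
      (⟨e s t, by simp⟩ : ((Finset.univ.image (e s) : Finset (Idx sys)) : Set (Idx sys))) := by
    intro t t' h
    have h1 : e s t = e s t' := congrArg Subtype.val h
    have h2 := congrArg (fun i : Idx sys => Sum.elim id Sigma.fst i) h1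
    simp only [e, Sum.elim_inr, Prod.mk.injEq] at h2
    exact Prod.ext (Subtype.ext h2.1) h2.2
  have h := hli.comp _ hinj
  convert h using 1
  funext t
  exact hs (t.1.1, t.2)

end IsLawFamily

end Law

/-! ### Averaging over measure-preserving maps -/

section Average

variable {α β : Type*} [MeasurableSpace α] [MeasurableSpace β] {π : Measure α} [SFinite π]
  {ρ : Measure β} [IsProbabilityMeasure ρ] {A : β → α → α}

theorem lintegral_average (hA : Measurable (Function.uncurry A))
    (hp : ∀ U, MeasurePreserving (A U) π π) {G : α → ENNReal} (hG : Measurable G) :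
    ∫⁻ x, G x ∂π = ∫⁻ x, ∫⁻ U, G (A U x) ∂ρ ∂π := by
  calc ∫⁻ x, G x ∂π = ∫⁻ _U, ∫⁻ x, G x ∂π ∂ρ := by simp
    _ = ∫⁻ U, ∫⁻ x, G (A U x) ∂π ∂ρ := lintegral_congr fun U => ((hp U).lintegral_comp hG).symm
    _ = _ := lintegral_lintegral_swap (hG.comp hA).aemeasurable

theorem ae_ae_average (hA : Measurable (Function.uncurry A))
    (hp : ∀ U, MeasurePreserving (A U) π π) {P : α → Prop} (hP : MeasurableSet {y | P y})
    (h : ∀ᵐ y ∂π, P y) : ∀ᵐ x ∂π, ∀ᵐ U ∂ρ, P (A U x) := by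
  have hset : MeasurableSet {z : β × α | P (A z.1 z.2)} := hA hP
  exact (Measure.ae_ae_comm hset).1
    (Filter.Eventually.of_forall fun U => (hp U).quasiMeasurePreserving.ae h)

end Average

/-! ### Received powers -/

section Power

variable {M N K : ℕ} {sys : System M N K} {ν : Idx sys → Measure (CVec M)}

theorem measurable_zfBeam_otherHat (F : NullBasis M N K) (n : Fin N) :
    Measurable fun z : (Idx sys → CVec M) × CVec (M - (N - 1) * K) =>
      zfBeam F n (otherHat n z.1) z.2 :=
  (measurable_zfBeam F n).comp
    (f := fun z : (Idx sys → CVec M) × CVec (M - (N - 1) * K) => (otherHat n z.1, z.2))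
    (((measurable_otherHat n).comp measurable_fst).prodMk measurable_snd)

theorem measurable_zfBeam_right (F : NullBasis M N K) (n : Fin N)
    (p : CVec (M - (N - 1) * K)) :
    Measurable fun x : Idx sys → CVec M => zfBeam F n (otherHat n x) p :=
  (measurable_zfBeam_otherHat F n).comp (f := fun x : Idx sys → CVec M => (x, p))
    (measurable_id.prodMk measurable_const)

/-- The user that a channel or a codeword belongs to. -/
def Idx.user : Idx sys → Fin N × Fin K := Sum.elim id Sigma.fst

/-- Apply a map to the channel and to the codewords of user `u`. -/
def actOn (u : Fin N × Fin K) (V : CVec M → CVec M) (x : Idx sys → CVec M) : Idx sys → CVec M :=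
  fun c => if c.user = u then V (x c) else x c

theorem famHat_actOn_self (u : Fin N × Fin K) (U : CVec M ≃ₗᵢ[ℂ] CVec M)
    (x : Idx sys → CVec M) : famHat (actOn u U x) u = U (famHat x u) := by
  simp only [famHat, actOn, Idx.user, Sum.elim_inl, Sum.elim_inr, id, if_true]
  rw [direction_map, quantize_map]

theorem famHat_actOn_of_ne {u u' : Fin N × Fin K} (hu : u' ≠ u) (V : CVec M → CVec M)
    (x : Idx sys → CVec M) : famHat (actOn u V x) u' = famHat x u' := by
  have h1 : actOn u V x (Sum.inl u') = x (Sum.inl u') := if_neg hu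
  have h2 : ∀ i, actOn u V x (Sum.inr ⟨u', i⟩) = x (Sum.inr ⟨u', i⟩) := fun i => if_neg hu
  simp only [famHat, h1, h2]

/-- Equivariance of the quantizer moves the entry of `u` and nothing else. Thus the beamformer of
cluster `n` depends on the rotation only through the rotated codeword. -/
theorem otherHat_actOn [DecidableEq ({m : Fin N // m ≠ n} × Fin K)] {u : Fin N × Fin K}
    (hu : u.1 ≠ n) (U : CVec M ≃ₗᵢ[ℂ] CVec M) (x : Idx sys → CVec M) :
    otherHat n (actOn u U x)
      = Function.update (otherHat n x) (⟨u.1, hu⟩, u.2) (U (famHat x u)) := by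
  funext t
  by_cases ht : t = (⟨u.1, hu⟩, u.2)
  · subst ht
    rw [Function.update_self]
    exact famHat_actOn_self u U x
  · rw [Function.update_of_ne ht]
    refine famHat_actOn_of_ne (fun h => ht ?_) U x
    subst h
    rfl

/-- The beamformer of a cluster uses no feedback from its own users, so their channels may be
resampled with the beam held fixed. -/
theorem otherHat_update_channel [DecidableEq (Idx sys)] (n : Fin N) (k : Fin K)
    (x : Idx sys → CVec M) (v : CVec M) :
    otherHat n (Function.update x (Sum.inl (n, k)) v) = otherHat n x := by
  funext t
  have ht : (t.1.1, t.2) ≠ (n, k) := fun h => t.1.2 (congrArg Prod.fst h)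
  simp only [otherHat, famHat]
  rw [Function.update_of_ne (by simpa using ht)]
  congr 1
  funext i
  exact Function.update_of_ne Sum.inr_ne_inl _ _

namespace IsLawFamily

theorem measurePreserving_actOn (hν : IsLawFamily ν) (u : Fin N × Fin K)
    (U : CVec M ≃ₗᵢ[ℂ] CVec M) :
    MeasurePreserving (actOn u U) (Measure.pi ν) (Measure.pi ν) := by
  have := hν.isProbabilityMeasure
  refine measurePreserving_pi (f := fun c v => if c.user = u then U v else v) ν ν fun c => ?_
  by_cases hc : c.user = u
  · simp only [hc, if_true]
    exact ⟨U.continuous.measurable, hν.map_unitary c U⟩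
  · simp only [hc, if_false]
    exact MeasurePreserving.id _

/-- The beamformer of a cluster is independent of the channels of its users: the effective channel
is a standard complex Gaussian. -/
theorem lintegral_own_channel (hν : IsLawFamily ν) (hZF : (N - 1) * K < M) (F : NullBasis M N K)
    (n : Fin N) (k : Fin K) {p : CVec (M - (N - 1) * K)} (hp : ‖p‖ = 1) {f : ℝ → ENNReal}
    (hf : Measurable f) :
    ∫⁻ x, f ‖⟪zfBeam F n (otherHat n x) p, x (Sum.inl (n, k))⟫_ℂ‖ ∂Measure.pi ν
      = ∫⁻ z, f ‖z‖ ∂complexGaussian := by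
  classical
  have := hν.isProbabilityMeasure
  have hm : Measurable fun x : Idx sys → CVec M =>
      f ‖⟪zfBeam F n (otherHat n x) p, x (Sum.inl (n, k))⟫_ℂ‖ :=
    hf.comp ((measurable_zfBeam_right F n p).inner (measurable_pi_apply (Sum.inl (n, k)))).norm
  rw [lintegral_pi_update ν (Sum.inl (n, k)) hm]
  simp only [otherHat_update_channel, Function.update_self]
  have : ∀ᵐ x ∂Measure.pi ν, ∫⁻ v, f ‖⟪zfBeam F n (otherHat n x) p, v⟫_ℂ‖ ∂ν (Sum.inl (n, k))
      = ∫⁻ z, f ‖z‖ ∂complexGaussian := by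
    filter_upwards [hν.ae_linearIndependent hZF n] with x hx
    rw [hν.channel]
    exact lintegral_rayleighLaw_inner (zfBeam_spec F n hx hp).1 hf
  rw [lintegral_congr_ae this]
  simp

/-- The law is unchanged when the channel and codebook of `u` are rotated together, so the integrand
may be averaged over the rotation. For fixed data this average is `lintegral_unitary_inner_sq`, with
`q` the selected codeword. -/
theorem lintegral_cross_channel (hν : IsLawFamily ν) (hM : 2 ≤ M) (hZF : (N - 1) * K < M)
    (F : NullBasis M N K) {i : Fin N} {u : Fin N × Fin K} (hu : u.1 ≠ i)
    {p : CVec (M - (N - 1) * K)} (hp : ‖p‖ = 1) :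
    ∫⁻ x, ENNReal.ofReal (‖⟪zfBeam F i (otherHat i x) p, x (Sum.inl u)⟫_ℂ‖ ^ 2) ∂Measure.pi ν
      = ∫⁻ x, ENNReal.ofReal ((‖x (Sum.inl u)‖ ^ 2 - ‖⟪famHat x u, x (Sum.inl u)⟫_ℂ‖ ^ 2) /
          ((M : ℝ) - 1)) ∂Measure.pi ν := by
  classical
  have := hν.isProbabilityMeasure
  obtain ⟨ρ, hρ1, hρ⟩ := exists_right_invariant_measure M
  let G : (Idx sys → CVec M) → ENNReal := fun x =>
    ENNReal.ofReal (‖⟪zfBeam F i (otherHat i x) p, x (Sum.inl u)⟫_ℂ‖ ^ 2)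
  have hG : Measurable G :=
    (((measurable_zfBeam_right F i p).inner
      (measurable_pi_apply (Sum.inl u))).norm.pow_const 2).ennreal_ofReal
  let A : UGroup M → (Idx sys → CVec M) → Idx sys → CVec M := fun U x =>
    actOn u (Unitary.linearIsometryEquiv U) x
  have hA : Measurable (Function.uncurry A) := by
    refine measurable_pi_lambda _ fun c => ?_
    by_cases hc : c.user = u
    · simp only [Function.uncurry, A, actOn, hc, if_true]
      exact UGroup.measurable_apply.comp
        (f := fun z : UGroup M × (Idx sys → CVec M) => (z.1, z.2 c))
        (measurable_fst.prodMk ((measurable_pi_apply c).comp measurable_snd))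
    · simp only [Function.uncurry, A, actOn, hc, if_false]
      exact (measurable_pi_apply c).comp measurable_snd
  have hpres : ∀ U, MeasurePreserving (A U) (Measure.pi ν) (Measure.pi ν) := fun U =>
    hν.measurePreserving_actOn u (Unitary.linearIsometryEquiv U)
  let good : (Idx sys → CVec M) → Prop := fun y => ‖zfBeam F i (otherHat i y) p‖ = 1 ∧
    ⟪zfBeam F i (otherHat i y) p, famHat y u⟫_ℂ = 0
  have hgood : MeasurableSet {y | good y} :=
    (measurableSet_eq_fun (measurable_zfBeam_right F i p).norm measurable_const).inter
      (measurableSet_eq_fun ((measurable_zfBeam_right F i p).inner (measurable_famHat u))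
        measurable_const)
  have hae : ∀ᵐ y ∂Measure.pi ν, good y := by
    filter_upwards [hν.ae_linearIndependent hZF i] with y hy
    have h := zfBeam_spec F i hy hp
    exact ⟨h.1, h.2 (⟨u.1, hu⟩, u.2)⟩
  have hae' : ∀ᵐ x ∂Measure.pi ν, ∀ᵐ U : UGroup M ∂ρ, good (A U x) := by
    exact ae_ae_average hA hpres hgood hae
  have hcodeword : ∀ᵐ x ∂Measure.pi ν, ‖famHat x u‖ = 1 := by
    filter_upwards [hν.ae_norm_codeword] with x hx
    obtain ⟨j, hj⟩ := exists_quantize_eq (fun i => x (Sum.inr ⟨u, i⟩)) (direction (x (Sum.inl u)))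
    rw [famHat, hj]
    exact hx _
  refine (lintegral_average (ρ := ρ) hA hpres hG).trans ?_
  refine lintegral_congr_ae ?_
  filter_upwards [hae', hcodeword] with x hx hq
  -- All quantized directions except that of `u` are frozen; at `v = U (famHat x u)` this is the
  -- beam of the rotated data.
  let W : CVec M → CVec M := fun v =>
    zfBeam F i (Function.update (otherHat i x) (⟨u.1, hu⟩, u.2) v) p
  have hW : Measurable W := (measurable_zfBeam F i).comp
    (f := fun v => (Function.update (otherHat i x) (⟨u.1, hu⟩, u.2) v, p))
    ((measurable_update (otherHat i x)).prodMk measurable_const)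
  have hWA : ∀ U : UGroup M, zfBeam F i (otherHat i (A U x)) p
      = W ((U : CVec M →L[ℂ] CVec M) (famHat x u)) := fun U => by
    simp only [A, W]
    rw [otherHat_actOn hu]
    rfl
  have hqA : ∀ U : UGroup M, famHat (A U x) u = (U : CVec M →L[ℂ] CVec M) (famHat x u) :=
    fun U => famHat_actOn_self u _ x
  have hhA : ∀ U : UGroup M, A U x (Sum.inl u) = (U : CVec M →L[ℂ] CVec M) (x (Sum.inl u)) := by
    intro U
    simp only [A, actOn, Idx.user, Sum.elim_inl, id, if_true]
    rfl
  rw [← lintegral_unitary_inner_sq hM hρ hq (x (Sum.inl u)) hW (by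
    filter_upwards [hx] with U hU
    rw [← hWA, ← hqA]
    exact hU)]
  exact lintegral_congr fun U => by simp only [G]; rw [hWA, hhA]

/-- Given the channel `v`, the integrand is `‖v‖²` times the squared sine of the quantization angle.
The codebook average of the latter is bounded uniformly in the direction of `v`, so `E ‖h‖² = M`
factors out. -/
theorem lintegral_channel_error_le (hν : IsLawFamily ν) (hM : 2 ≤ M) (u : Fin N × Fin K) :
    ∫⁻ x, ENNReal.ofReal (‖x (Sum.inl u)‖ ^ 2 - ‖⟪famHat x u, x (Sum.inl u)⟫_ℂ‖ ^ 2) ∂Measure.pi ν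
      ≤ ENNReal.ofReal (M * (((2 ^ sys.bits u.1 u.2 : ℕ) : ℝ) ^ (-1 / ((M : ℝ) - 1)) *
          Real.Gamma (1 / ((M : ℝ) - 1) + 1))) := by
  have := hν.isProbabilityMeasure
  let g : Option (Fin (2 ^ sys.bits u.1 u.2)) → Idx sys :=
    fun o => o.elim (Sum.inl u) fun i => Sum.inr ⟨u, i⟩
  have hg : Function.Injective g := by
    rintro (_ | i) (_ | j) h
    · rfl
    · cases h
    · cases h
    · simpa [g] using h
  let f : CVec M → (Fin (2 ^ sys.bits u.1 u.2) → CVec M) → ENNReal := fun v C =>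
    ENNReal.ofReal (‖v‖ ^ 2 - ‖⟪quantize C (direction v), v⟫_ℂ‖ ^ 2)
  have hquant : Measurable fun z : CVec M × (Fin (2 ^ sys.bits u.1 u.2) → CVec M) =>
      quantize z.2 (direction z.1) :=
    measurable_quantize.comp (f := fun z : CVec M × (Fin (2 ^ sys.bits u.1 u.2) → CVec M) =>
      (z.2, direction z.1)) (measurable_snd.prodMk (measurable_direction.comp measurable_fst))
  have hf : Measurable (Function.uncurry f) :=
    ((measurable_fst.norm.pow_const 2).sub
      ((hquant.inner measurable_fst).norm.pow_const 2)).ennreal_ofReal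
  refine (lintegral_pi_marginal (ν := ν) hg hf).trans_le ?_
  have hinner : ∀ v : CVec M, ∫⁻ C, f v C ∂Measure.pi (fun i => ν (g (some i)))
      ≤ ENNReal.ofReal (((2 ^ sys.bits u.1 u.2 : ℕ) : ℝ) ^ (-1 / ((M : ℝ) - 1)) *
          Real.Gamma (1 / ((M : ℝ) - 1) + 1)) * ENNReal.ofReal (‖v‖ ^ 2) := by
    intro v
    rcases eq_or_ne v 0 with rfl | hv
    · simp [f]
    have hdir : ‖direction v‖ = 1 := norm_direction hv
    have hfv : ∀ C, f v C = ENNReal.ofReal (1 - ‖⟪direction v, quantize C (direction v)⟫_ℂ‖ ^ 2)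
        * ENNReal.ofReal (‖v‖ ^ 2) := by
      intro C
      rw [mul_comm, ← ENNReal.ofReal_mul (by positivity)]
      simp only [f]
      congr 1
      conv_lhs => rw [← norm_smul_direction v]
      rw [norm_smul, hdir, inner_smul_right, norm_mul, Complex.norm_real, norm_norm,
        norm_inner_symm, norm_smul_direction]
      ring
    simp_rw [hfv]
    have hm : Measurable fun C : Fin (2 ^ sys.bits u.1 u.2) → CVec M =>
        1 - ‖⟪direction v, quantize C (direction v)⟫_ℂ‖ ^ 2 :=
      measurable_const.sub ((measurable_const.inner
        (hquant.comp (measurable_const.prodMk measurable_id))).norm.pow_const 2)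
    rw [lintegral_mul_const _ hm.ennreal_ofReal]
    refine mul_le_mul_left ?_ _
    have hunif : ∀ i, IsUniformOnSphere (ν (g (some i))) := fun i => hν.codeword _
    refine lintegral_quantization_error_le hM (by positivity) hunif hdir hm ?_ ?_
    · have hae : ∀ᵐ C ∂Measure.pi (fun i => ν (g (some i))), ∀ i, ‖C i‖ = 1 :=
        ae_all_iff.2 fun i => ae_eval_pi (ν := fun i => ν (g (some i))) i (hunif i).norm_eq_one
      filter_upwards [hae] with C hC
      obtain ⟨j, hj⟩ := exists_quantize_eq C (direction v)
      have h1 := norm_inner_le_norm (𝕜 := ℂ) (direction v) (quantize C (direction v))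
      rw [hdir, hj, hC, one_mul] at h1
      rw [hj, sub_nonneg]
      exact pow_le_one₀ (norm_nonneg _) h1
    · intro C j
      have := pow_le_pow_left₀ (norm_nonneg _) (norm_inner_le_quantize C (direction v) j) 2
      linarith
  refine (lintegral_mono hinner).trans ?_
  rw [lintegral_const_mul _ (by fun_prop)]
  simp only [g, Option.elim_none]
  rw [hν.channel, lintegral_norm_sq_rayleighLaw, ← ENNReal.ofReal_natCast M,
    ← ENNReal.ofReal_mul' (by positivity), mul_comm]

theorem lintegral_cross_channel_le (hν : IsLawFamily ν) (hM : 2 ≤ M) (hZF : (N - 1) * K < M)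
    (F : NullBasis M N K) {i : Fin N} {u : Fin N × Fin K} (hu : u.1 ≠ i)
    {p : CVec (M - (N - 1) * K)} (hp : ‖p‖ = 1) :
    ∫⁻ x, ENNReal.ofReal (‖⟪zfBeam F i (otherHat i x) p, x (Sum.inl u)⟫_ℂ‖ ^ 2) ∂Measure.pi ν
      ≤ ENNReal.ofReal (Real.Gamma ((2 * (M : ℝ) - 1) / ((M : ℝ) - 1)) *
        (2 : ℝ) ^ (-((sys.bits u.1 u.2 : ℝ) / ((M : ℝ) - 1)))) := by
  have hM' : (0 : ℝ) < (M : ℝ) - 1 := by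
    have : (2 : ℝ) ≤ M := by exact_mod_cast hM
    linarith
  rw [hν.lintegral_cross_channel hM hZF F hu hp]
  simp_rw [div_eq_mul_inv _ ((M : ℝ) - 1)]
  have herr := hν.lintegral_channel_error_le hM u
  simp_rw [div_eq_mul_inv _ ((M : ℝ) - 1)] at herr
  simp_rw [ENNReal.ofReal_mul' (inv_nonneg.2 hM'.le)]
  rw [lintegral_mul_const' _ _ ENNReal.ofReal_ne_top]
  refine (mul_le_mul_left herr _).trans_eq ?_
  rw [← ENNReal.ofReal_mul' (inv_nonneg.2 hM'.le)]
  congr 1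
  -- With `a = M/(M-1) = 1 + 1/(M-1)` this is `Γ(a + 1) = a Γ(a)`; the factor `a` joins `E ‖h‖² = M`
  -- with the division by `M - 1`.
  have hG : Real.Gamma ((2 * (M : ℝ) - 1) * ((M : ℝ) - 1)⁻¹)
      = M / ((M : ℝ) - 1) * Real.Gamma (1 * ((M : ℝ) - 1)⁻¹ + 1) := by
    have h1 : (2 * (M : ℝ) - 1) * ((M : ℝ) - 1)⁻¹ = M / ((M : ℝ) - 1) + 1 := by
      field_simp; ring
    have h2 : 1 * ((M : ℝ) - 1)⁻¹ + 1 = M / ((M : ℝ) - 1) := by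
      field_simp; ring
    rw [h1, h2, Real.Gamma_add_one]
    have : (0 : ℝ) < M := by linarith
    positivity
  have hpow : ((2 ^ sys.bits u.1 u.2 : ℕ) : ℝ) ^ (-1 * ((M : ℝ) - 1)⁻¹)
      = (2 : ℝ) ^ (-((sys.bits u.1 u.2 : ℝ) * ((M : ℝ) - 1)⁻¹)) := by
    push_cast
    rw [← Real.rpow_natCast, ← Real.rpow_mul zero_le_two]
    congr 1
    ring
  rw [hG, hpow]
  ring

end IsLawFamily

end Power

/-! ### The exponential integral -/

/-- The substitution `1 + s t` for the integration variable, with both sides zero at `s = 0`. The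
right side is what the layer cake formula produces for the mean of a logarithm. -/
theorem expE1_eq_integral {s : ℝ} (hs : 0 ≤ s) :
    expE1 s = ∫ t in Set.Ioi (0 : ℝ), Real.exp (-t) * (s / (1 + s * t)) := by
  rcases hs.eq_or_lt with rfl | hs
  · simp [expE1]
  have himg : (fun t : ℝ => 1 + s * t) '' Set.Ioi 0 = Set.Ioi 1 := by
    ext y
    constructor
    · rintro ⟨t, ht, rfl⟩
      have : 0 < s * t := mul_pos hs ht
      simpa using this
    · intro hy
      have hy' : 1 < y := hy
      refine ⟨(y - 1) / s, div_pos (by linarith) hs, ?_⟩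
      simp only
      field_simp
      ring
  have hsub := integral_image_eq_integral_abs_deriv_smul (s := Set.Ioi (0 : ℝ))
    (f := fun t : ℝ => 1 + s * t) (f' := fun _ => s) measurableSet_Ioi
    (fun x _ => by
      simpa using (((hasDerivAt_id x).const_mul s).const_add 1).hasDerivWithinAt)
    (fun a _ b _ h => by
      have h' : s * a = s * b := by simpa using h
      exact mul_left_cancel₀ hs.ne' h')
    (fun u : ℝ => Real.exp (-(1 / s * u)) / u ^ 1)
  rw [himg] at hsub
  rw [expE1, if_neg hs.ne', expIntegral, hsub, ← integral_const_mul]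
  refine setIntegral_congr_fun measurableSet_Ioi fun t ht => ?_
  simp only [smul_eq_mul, pow_one]
  rw [abs_of_pos hs]
  have h1 : Real.exp (1 / s) * Real.exp (-(1 / s * (1 + s * t))) = Real.exp (-t) := by
    rw [← Real.exp_add]
    congr 1
    field_simp
    ring
  rw [← h1]
  ring

theorem expE1_nonneg {s : ℝ} (hs : 0 ≤ s) : 0 ≤ expE1 s := by
  rw [expE1_eq_integral hs]
  refine setIntegral_nonneg measurableSet_Ioi fun t ht => ?_
  have ht' : (0 : ℝ) < t := ht
  positivity

/-- The ergodic capacity of a Rayleigh fading channel. -/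
theorem lintegral_log_complexGaussian {s : ℝ} (hs : 0 ≤ s) :
    ∫⁻ z, ENNReal.ofReal (Real.log (1 + s * ‖z‖ ^ 2)) ∂complexGaussian
      = ENNReal.ofReal (expE1 s) := by
  have hprim : ∀ y : ℝ, 0 ≤ y → ∫ t in (0 : ℝ)..y, s / (1 + s * t) = Real.log (1 + s * y) := by
    intro y hy
    have hpos : ∀ t ∈ Set.uIcc 0 y, 0 < 1 + s * t := by
      intro t ht
      rw [Set.uIcc_of_le hy] at ht
      have := mul_nonneg hs ht.1
      linarith
    rw [intervalIntegral.integral_eq_sub_of_hasDerivAt (f := fun t => Real.log (1 + s * t))]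
    · simp
    · intro t ht
      have h1 : HasDerivAt (fun t : ℝ => 1 + s * t) s t := by
        simpa using ((hasDerivAt_id t).const_mul s).const_add 1
      exact h1.log (hpos t ht).ne'
    · refine ContinuousOn.intervalIntegrable ?_
      exact continuousOn_const.div (by fun_prop) fun t ht => (hpos t ht).ne'
  -- Layer cake with the derivative `s/(1 + s t)` of `log(1 + s t)`: the mean is the integral of
  -- this derivative against the tail `e^{-t}`.
  have hlayer := lintegral_comp_eq_lintegral_meas_lt_mul complexGaussian
    (f := fun z => ‖z‖ ^ 2) (g := fun t => s / (1 + s * t))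
    (Filter.Eventually.of_forall fun z => by positivity) (by fun_prop)
    (fun y hy => by
      refine ContinuousOn.intervalIntegrable ?_
      refine continuousOn_const.div (by fun_prop) fun t ht => ?_
      rw [Set.uIcc_of_le hy.le] at ht
      have := mul_nonneg hs ht.1
      linarith)
    ((ae_restrict_iff' measurableSet_Ioi).2 <| Filter.Eventually.of_forall fun t ht => by
      have ht' : (0 : ℝ) < t := ht
      positivity)
  simp_rw [fun z : ℂ => hprim (‖z‖ ^ 2) (by positivity)] at hlayer
  rw [hlayer, expE1_eq_integral hs, ofReal_integral_eq_lintegral_ofReal]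
  · refine setLIntegral_congr_fun measurableSet_Ioi fun t ht => ?_
    have ht' : (0 : ℝ) < t := ht
    rw [complexGaussian_normSq_gt ht'.le, ← ENNReal.ofReal_mul (Real.exp_pos _).le]
  · have hexp : IntegrableOn (fun t : ℝ => s * Real.exp (-t)) (Set.Ioi 0) := by
      have := integrableOn_exp_mul_Ioi (a := -1) (by norm_num) 0
      simp only [neg_mul, one_mul] at this
      exact this.const_mul s
    refine Integrable.mono' hexp (by fun_prop) ?_
    refine (ae_restrict_iff' measurableSet_Ioi).2 <| Filter.Eventually.of_forall fun t ht => ?_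
    have ht' : (0 : ℝ) < t := ht
    rw [Real.norm_of_nonneg (by positivity), mul_comm]
    refine mul_le_mul_of_nonneg_right ?_ (Real.exp_pos _).le
    exact div_le_self hs (by nlinarith)
  · refine (ae_restrict_iff' measurableSet_Ioi).2 <| Filter.Eventually.of_forall fun t ht => ?_
    have ht' : (0 : ℝ) < t := ht
    simp only [Pi.zero_apply]
    positivity

/-! ### Pointwise bounds -/

/-- The interference that leaks through the quantization error is the interference received by
the channel itself. -/
theorem sin_sq_mul_norm_err {d : ℕ} {h q : CVec d} {w : Fin d → ℂ} (hq : ‖q‖ = 1)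
    (hw : rowMul q w = 0) :
    Real.sin (Real.arccos ‖rowMulStar (direction h) q‖) ^ 2 * ‖h‖ ^ 2 *
      ‖rowMul (direction (direction h - rowMulStar (direction h) q • q)) w‖ ^ 2
      = ‖rowMul h w‖ ^ 2 := by
  rcases eq_or_ne h 0 with rfl | hh
  · simp [rowMul]
  have hu : ‖direction h‖ = 1 := norm_direction hh
  simp only [rowMulStar_eq_inner, rowMul_eq_inner] at hw ⊢
  set u := direction h with hudef
  set a := conjVec w
  set r := u - ⟪q, u⟫_ℂ • q with hr
  have hqq : ⟪q, q⟫_ℂ = 1 := by rw [inner_self_eq_norm_sq_to_K, hq]; simp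
  have hqr : ⟪q, r⟫_ℂ = 0 := by
    rw [hr, inner_sub_right, inner_smul_right, hqq, mul_one, sub_self]
  -- Pythagoras: `sin θ` is the length of the error component `r`, so multiplying by `sin²θ` undoes
  -- its normalization.
  have hnorm : 1 - ‖⟪q, u⟫_ℂ‖ ^ 2 = ‖r‖ ^ 2 := by
    have h1 : u = ⟪q, u⟫_ℂ • q + r := by rw [hr]; abel
    have h2 := norm_add_sq_eq_norm_sq_add_norm_sq_of_inner_eq_zero (𝕜 := ℂ) (⟪q, u⟫_ℂ • q) r
      (by rw [inner_smul_left, hqr, mul_zero])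
    rw [← h1, norm_smul, hq, hu, mul_one] at h2
    nlinarith
  have hsin : Real.sin (Real.arccos ‖⟪q, u⟫_ℂ‖) ^ 2 = ‖r‖ ^ 2 := by
    rw [Real.sin_arccos, Real.sq_sqrt, hnorm]
    rw [hnorm]; positivity
  have har : ⟪a, r⟫_ℂ = ⟪a, u⟫_ℂ := by
    rw [hr, inner_sub_right, inner_smul_right, hw, mul_zero, sub_zero]
  -- This covers perfect quantization, `r = 0`, where `direction r` is `0`.
  have h1 : ‖r‖ * ‖⟪a, direction r⟫_ℂ‖ = ‖⟪a, r⟫_ℂ‖ := by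
    conv_rhs => rw [← norm_smul_direction r]
    rw [inner_smul_right, norm_mul, Complex.norm_real, norm_norm]
  have h2 : ‖h‖ * ‖⟪a, u⟫_ℂ‖ = ‖⟪a, h⟫_ℂ‖ := by
    conv_rhs => rw [← norm_smul_direction h]
    rw [inner_smul_right, norm_mul, Complex.norm_real, norm_norm]
  rw [hsin, ← h2, ← har, ← h1]
  ring

theorem logb_two_one_add_nonneg {x : ℝ} (hx : 0 ≤ x) : 0 ≤ Real.logb 2 (1 + x) :=
  Real.logb_nonneg one_lt_two (by linarith)

theorem logb_two_one_add_le {x : ℝ} (hx : 0 ≤ x) : Real.logb 2 (1 + x) ≤ x / Real.log 2 := by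
  rw [Real.logb]
  refine div_le_div_of_nonneg_right ?_ (Real.log_pos one_lt_two).le
  have := Real.log_le_sub_one_of_pos (by linarith : 0 < 1 + x)
  linarith

/-- The tangent line bound for the logarithm. -/
theorem logb_two_le_tangent {y m : ℝ} (hy : 0 < y) (hm : 0 < m) :
    Real.logb 2 y ≤ Real.logb 2 m + (y - m) / (m * Real.log 2) := by
  have hl : 0 < Real.log 2 := Real.log_pos one_lt_two
  have h := Real.log_le_sub_one_of_pos (div_pos hy hm)
  rw [Real.log_div hy.ne' hm.ne'] at h
  have h1 : Real.log y ≤ Real.log m + (y - m) / m := by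
    have : (y - m) / m = y / m - 1 := by field_simp
    linarith
  calc Real.logb 2 y = Real.log y / Real.log 2 := rfl
    _ ≤ (Real.log m + (y - m) / m) / Real.log 2 := div_le_div_of_nonneg_right h1 hl.le
    _ = _ := by rw [add_div, div_div, Real.logb]

/-- Once both rates are split into differences of logarithms, the two sides differ by `log₂(1 + (s₂
+ t) g + i) - log₂(1 + (s₂ + t) g)`, which is nonnegative and is dropped. -/
theorem logb_ideal_sub_le {s₂ t g i : ℝ} (hs : 0 ≤ s₂) (ht : 0 ≤ t) (hg : 0 ≤ g) (hi : 0 ≤ i) :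
    Real.logb 2 ((1 + (s₂ + t) * g) / (1 + s₂ * g)) - Real.logb 2 (1 + t * g / (1 + s₂ * g + i))
      ≤ Real.logb 2 (1 + s₂ * g + i) - Real.logb 2 (1 + s₂ * g) := by
  have h1 : 0 < 1 + s₂ * g := by positivity
  have h2 : 0 < 1 + (s₂ + t) * g := by positivity
  have h3 : 0 < 1 + s₂ * g + i := by positivity
  have h4 : 0 < 1 + (s₂ + t) * g + i := by positivity
  have h5 : 1 + t * g / (1 + s₂ * g + i) = (1 + (s₂ + t) * g + i) / (1 + s₂ * g + i) := by
    field_simp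
    ring
  rw [h5, Real.logb_div h2.ne' h1.ne', Real.logb_div h4.ne' h3.ne']
  have h6 : Real.logb 2 (1 + (s₂ + t) * g) ≤ Real.logb 2 (1 + (s₂ + t) * g + i) :=
    Real.logb_le_logb_of_le one_lt_two h2 (by linarith)
  linarith

namespace System

variable {M N K : ℕ} (sys : System M N K)

theorem gain_pos (n : Fin N) (k : Fin K) : 0 < sys.gain n k :=
  Real.rpow_pos_of_pos (sys.dist_pos n k) _

theorem snr_nonneg (n : Fin N) (k : Fin K) : 0 ≤ sys.gain n k / sys.noiseVar n k :=
  (div_pos (sys.gain_pos n k) (sys.noiseVar_pos n k)).le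

theorem S1_eq (n : Fin N) (k : Fin K) :
    sys.S1 n k = sys.S2 n k + sys.gain n k / sys.noiseVar n k * sys.power n k := by
  rw [S1, S2, ← Finset.Iio_insert, Finset.sum_insert (by simp)]
  ring

theorem S2_nonneg (n : Fin N) (k : Fin K) : 0 ≤ sys.S2 n k :=
  mul_nonneg (sys.snr_nonneg n k) (Finset.sum_nonneg fun _ _ => sys.power_nonneg _ _)

end System

/-! ### From the probability space to the product law -/

namespace RandomData

variable {M N K : ℕ} {sys : System M N K} {Ω : Type*}

theorem rowMul_w_eq_inner (X : RandomData sys Ω) (F : NullBasis M N K) (i : Fin N) (x : CVec M)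
    (ω : Ω) : rowMul x (X.w F i ω)
      = ⟪zfBeam F i (otherHat i fun c => X.family c ω) (X.p i ω), x⟫_ℂ :=
  rowMul_eq_inner _ _

/-- The normalized power of the interference from the other clusters. -/
noncomputable def leak (X : RandomData sys Ω) (F : NullBasis M N K) (n : Fin N) (k : Fin K)
    (ω : Ω) : ℝ :=
  sys.gain n k / sys.noiseVar n k * ∑ i ∈ Finset.univ.erase n,
    ‖rowMul (X.h n k ω) (X.w F i ω)‖ ^ 2 * ∑ l, sys.power i l

theorem leak_nonneg (X : RandomData sys Ω) (F : NullBasis M N K) (n : Fin N) (k : Fin K) (ω : Ω) :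
    0 ≤ X.leak F n k ω :=
  mul_nonneg (sys.snr_nonneg n k) (Finset.sum_nonneg fun _ _ => mul_nonneg (by positivity)
    (Finset.sum_nonneg fun _ _ => sys.power_nonneg _ _))

variable [MeasurableSpace Ω] {μ : Measure Ω} {X : RandomData sys Ω}

theorem measurable_received (F : NullBasis M N K) (i : Fin N) (c : Idx sys) :
    Measurable fun z : CVec (M - (N - 1) * K) × (Idx sys → CVec M) =>
      ⟪zfBeam F i (otherHat i z.2) z.1, z.2 c⟫_ℂ := by
  have h1 : Measurable fun z : CVec (M - (N - 1) * K) × (Idx sys → CVec M) =>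
      zfBeam F i (otherHat i z.2) z.1 :=
    (measurable_zfBeam_otherHat F i).comp (f := fun z : CVec (M - (N - 1) * K) ×
      (Idx sys → CVec M) => (z.2, z.1)) (measurable_snd.prodMk measurable_fst)
  have h2 : Measurable fun z : CVec (M - (N - 1) * K) × (Idx sys → CVec M) => z.2 c :=
    (measurable_pi_apply c).comp measurable_snd
  exact h1.inner h2

/-- The laws of the channels and codewords. -/
noncomputable def law (X : RandomData sys Ω) (μ : Measure Ω) (c : Idx sys) : Measure (CVec M) :=
  μ.map (X.family c)

namespace IsModel

theorem measurable_family (hX : X.IsModel μ) (c : Idx sys) : Measurable (X.family c) := by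
  rcases c with u | c
  · exact hX.measurable_h _ _
  · exact hX.measurable_codebook _ _ _

theorem isLawFamily (hX : X.IsModel μ) : IsLawFamily (X.law μ) where
  channel u := hX.law_h u.1 u.2
  codeword c := hX.law_codebook c.1.1 c.1.2 c.2

theorem measurable_fam (hX : X.IsModel μ) : Measurable fun ω c => X.family c ω :=
  measurable_pi_lambda _ hX.measurable_family

theorem map_pair [IsProbabilityMeasure μ] (hX : X.IsModel μ) (i : Fin N) :
    μ.map (fun ω => (X.p i ω, fun c => X.family c ω))
      = (μ.map (X.p i)).prod (Measure.pi (X.law μ)) := by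
  have h1 := (hX.indep_p i).map_prod_eq_prod_map_map (hX.measurable_p i).aemeasurable
    hX.measurable_fam.aemeasurable
  have h2 := hX.indep.map_fun_eq_pi_map fun c => (hX.measurable_family c).aemeasurable
  rw [h1, h2]
  rfl

/-- The channels and codewords are integrated first, so that the results for a fixed unit vector `p`
apply. Every expectation taken this way involves a single beam, and the interference is assembled by
linearity. -/
theorem lintegral_pair [IsProbabilityMeasure μ] (hX : X.IsModel μ) (i : Fin N)
    {f : CVec (M - (N - 1) * K) → (Idx sys → CVec M) → ENNReal}
    (hf : Measurable (Function.uncurry f)) :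
    ∫⁻ ω, f (X.p i ω) (fun c => X.family c ω) ∂μ
      = ∫⁻ p, ∫⁻ x, f p x ∂Measure.pi (X.law μ) ∂μ.map (X.p i) := by
  have := hX.isLawFamily.isProbabilityMeasure
  have hm : Measurable fun ω => (X.p i ω, fun c => X.family c ω) :=
    (hX.measurable_p i).prodMk hX.measurable_fam
  have h1 := lintegral_map (μ := μ) hf hm
  rw [hX.map_pair i] at h1
  exact h1.symm.trans (lintegral_prod _ hf.aemeasurable)

theorem measurable_rowMul_w (hX : X.IsModel μ) (F : NullBasis M N K) (i : Fin N)
    {x : Ω → CVec M} (hx : Measurable x) : Measurable fun ω => rowMul (x ω) (X.w F i ω) := by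
  simp_rw [rowMul_w_eq_inner]
  have h1 : Measurable fun ω => zfBeam F i (otherHat i fun c => X.family c ω) (X.p i ω) :=
    (measurable_zfBeam_otherHat F i).comp (f := fun ω => ((fun c => X.family c ω), X.p i ω))
      (hX.measurable_fam.prodMk (hX.measurable_p i))
  exact h1.inner hx

theorem lintegral_own [IsProbabilityMeasure μ] (hX : X.IsModel μ) (hZF : (N - 1) * K < M)
    (F : NullBasis M N K) (n : Fin N) (k : Fin K) {f : ℝ → ENNReal} (hf : Measurable f) :
    ∫⁻ ω, f ‖rowMul (X.h n k ω) (X.w F n ω)‖ ∂μ = ∫⁻ z, f ‖z‖ ∂complexGaussian := by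
  have := (hX.law_p n).isProbabilityMeasure
  simp_rw [rowMul_w_eq_inner]
  let G : CVec (M - (N - 1) * K) → (Idx sys → CVec M) → ENNReal := fun p x =>
    f ‖⟪zfBeam F n (otherHat n x) p, x (Sum.inl (n, k))⟫_ℂ‖
  have hG : Measurable (Function.uncurry G) := 
    hf.comp (measurable_received F n (Sum.inl (n, k))).norm
  refine (hX.lintegral_pair n hG).trans ?_
  have hae : ∀ᵐ p ∂μ.map (X.p n), ∫⁻ x, G p x ∂Measure.pi (X.law μ)
      = ∫⁻ z, f ‖z‖ ∂complexGaussian := by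
    filter_upwards [(hX.law_p n).norm_eq_one] with p hp
    exact hX.isLawFamily.lintegral_own_channel hZF F n k hp hf
  rw [lintegral_congr_ae hae]
  simp

theorem lintegral_cross_le [IsProbabilityMeasure μ] (hX : X.IsModel μ) (hM : 2 ≤ M)
    (hZF : (N - 1) * K < M) (F : NullBasis M N K) {n i : Fin N} (hi : n ≠ i) (k : Fin K) :
    ∫⁻ ω, ENNReal.ofReal (‖rowMul (X.h n k ω) (X.w F i ω)‖ ^ 2) ∂μ
      ≤ ENNReal.ofReal (Real.Gamma ((2 * (M : ℝ) - 1) / ((M : ℝ) - 1)) *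
        (2 : ℝ) ^ (-((sys.bits n k : ℝ) / ((M : ℝ) - 1)))) := by
  have := (hX.law_p i).isProbabilityMeasure
  simp_rw [rowMul_w_eq_inner]
  let G : CVec (M - (N - 1) * K) → (Idx sys → CVec M) → ENNReal := fun p x =>
    ENNReal.ofReal (‖⟪zfBeam F i (otherHat i x) p, x (Sum.inl (n, k))⟫_ℂ‖ ^ 2)
  have hG : Measurable (Function.uncurry G) :=
    ((measurable_received F i (Sum.inl (n, k))).norm.pow_const 2).ennreal_ofReal
  refine (hX.lintegral_pair i hG).trans_le ?_
  have hae : ∀ᵐ p ∂μ.map (X.p i), ∫⁻ x, G p x ∂Measure.pi (X.law μ)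
      ≤ ENNReal.ofReal (Real.Gamma ((2 * (M : ℝ) - 1) / ((M : ℝ) - 1)) *
        (2 : ℝ) ^ (-((sys.bits n k : ℝ) / ((M : ℝ) - 1)))) := by
    filter_upwards [(hX.law_p i).norm_eq_one] with p hp
    exact hX.isLawFamily.lintegral_cross_channel_le hM hZF F (u := (n, k)) hi hp
  refine (lintegral_mono_ae hae).trans ?_
  simp

theorem ae_of_family (hX : X.IsModel μ) {P : (Idx sys → CVec M) → Prop}
    (h : ∀ᵐ x ∂Measure.pi (X.law μ), P x) : ∀ᵐ ω ∂μ, P fun c => X.family c ω := by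
  have h2 := hX.indep.map_fun_eq_pi_map fun c => (hX.measurable_family c).aemeasurable
  have h3 : ∀ᵐ x ∂μ.map (fun ω c => X.family c ω), P x := by rw [h2]; exact h
  exact ae_of_ae_map hX.measurable_fam.aemeasurable h3

theorem ae_norm_hHat [IsProbabilityMeasure μ] (hX : X.IsModel μ) (n : Fin N) (k : Fin K) :
    ∀ᵐ ω ∂μ, ‖X.hHat n k ω‖ = 1 := by
  filter_upwards [hX.ae_of_family hX.isLawFamily.ae_norm_codeword] with ω hω
  obtain ⟨j, hj⟩ := exists_quantize_eq (fun i => X.codebook n k i ω) (X.hDir n k ω)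
  rw [hHat, hj]
  exact hω ⟨(n, k), j⟩

/-- Zero forcing: the beamformer of another cluster is orthogonal to the quantized direction. -/
theorem ae_rowMul_hHat [IsProbabilityMeasure μ] (hX : X.IsModel μ)
    (hZF : (N - 1) * K < M) (F : NullBasis M N K) {n i : Fin N} (hi : n ≠ i) (k : Fin K) :
    ∀ᵐ ω ∂μ, rowMul (X.hHat n k ω) (X.w F i ω) = 0 := by
  filter_upwards [hX.ae_of_family (hX.isLawFamily.ae_linearIndependent hZF i),
    ae_of_ae_map (hX.measurable_p i).aemeasurable (hX.law_p i).norm_eq_one] with ω h1 h2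
  rw [rowMul_w_eq_inner]
  exact (zfBeam_spec F i h1 h2).2 (⟨n, hi⟩, k)

/-- Almost surely all other beams annihilate the quantized direction, so the error term of `sinr` is
the interference received through the channel itself; dividing by the noise variance gives the
normalized form. -/
theorem ae_instRate_eq [IsProbabilityMeasure μ] (hX : X.IsModel μ)
    (hZF : (N - 1) * K < M) (F : NullBasis M N K)
    (n : Fin N) (k : Fin K) :
    ∀ᵐ ω ∂μ, X.instRate F n k ω = Real.logb 2 (1 +
      sys.gain n k / sys.noiseVar n k * sys.power n k * ‖rowMul (X.h n k ω) (X.w F n ω)‖ ^ 2 /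
        (1 + sys.S2 n k * ‖rowMul (X.h n k ω) (X.w F n ω)‖ ^ 2 + X.leak F n k ω)) := by
  have hall : ∀ᵐ ω ∂μ, ∀ i, n ≠ i → rowMul (X.hHat n k ω) (X.w F i ω) = 0 :=
    ae_all_iff.2 fun i => by
      by_cases hi : n = i
      · exact Filter.Eventually.of_forall fun ω h => absurd hi h
      · filter_upwards [hX.ae_rowMul_hHat hZF F hi k] with ω hω _
        exact hω
  filter_upwards [hX.ae_norm_hHat n k, hall] with ω hq hw
  have hσ := sys.noiseVar_pos n k
  have hI : sys.gain n k * Real.sin (X.theta n k ω) ^ 2 * ‖X.h n k ω‖ ^ 2 *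
      (∑ i ∈ Finset.univ.erase n, ‖rowMul (X.err n k ω) (X.w F i ω)‖ ^ 2 * ∑ l, sys.power i l)
      = sys.noiseVar n k * X.leak F n k ω := by
    have h1 : sys.noiseVar n k * X.leak F n k ω = sys.gain n k * ∑ i ∈ Finset.univ.erase n,
        ‖rowMul (X.h n k ω) (X.w F i ω)‖ ^ 2 * ∑ l, sys.power i l := by
      rw [leak]
      field_simp
    rw [h1, Finset.mul_sum, Finset.mul_sum]
    refine Finset.sum_congr rfl fun i hi => ?_
    have h2 : Real.sin (X.theta n k ω) ^ 2 * ‖X.h n k ω‖ ^ 2 *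
        ‖rowMul (X.err n k ω) (X.w F i ω)‖ ^ 2 = ‖rowMul (X.h n k ω) (X.w F i ω)‖ ^ 2 :=
      sin_sq_mul_norm_err hq (hw i (Finset.ne_of_mem_erase hi).symm)
    rw [← h2]
    ring
  rw [instRate, sinr, hI]
  congr 2
  have h2 : sys.gain n k * ‖rowMul (X.h n k ω) (X.w F n ω)‖ ^ 2 *
        (∑ j ∈ Finset.Iio k, sys.power n j) + sys.noiseVar n k * X.leak F n k ω + sys.noiseVar n k
      = sys.noiseVar n k *
        (1 + sys.S2 n k * ‖rowMul (X.h n k ω) (X.w F n ω)‖ ^ 2 + X.leak F n k ω) := by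
    rw [System.S2]
    field_simp
    ring
  rw [h2, ← div_div]
  congr 1
  field_simp

end IsModel

end RandomData

/-! ### The rate loss -/

theorem integrable_of_lintegral_ofReal_le {α : Type*} [MeasurableSpace α] {μ : Measure α}
    {f : α → ℝ} (hm : Measurable f) (h0 : ∀ x, 0 ≤ f x) {c : ℝ} (hc : 0 ≤ c)
    (h : ∫⁻ x, ENNReal.ofReal (f x) ∂μ ≤ ENNReal.ofReal c) :
    Integrable f μ ∧ ∫ x, f x ∂μ ≤ c := by
  constructor
  · refine ⟨hm.aestronglyMeasurable, ?_⟩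
    rw [hasFiniteIntegral_iff_ofReal (Filter.Eventually.of_forall h0)]
    exact h.trans_lt ENNReal.ofReal_lt_top
  · rw [integral_eq_lintegral_of_nonneg_ae (Filter.Eventually.of_forall h0)
      hm.aestronglyMeasurable]
    exact ENNReal.toReal_le_of_le_ofReal hc h

namespace RandomData.IsModel

variable {M N K : ℕ} {sys : System M N K} {Ω : Type*} [MeasurableSpace Ω] {μ : Measure Ω}
  {X : RandomData sys Ω} [IsProbabilityMeasure μ]

theorem integrable_own (hX : X.IsModel μ) (hZF : (N - 1) * K < M) (F : NullBasis M N K) (n : Fin N)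
    (k : Fin K) : Integrable (fun ω => ‖rowMul (X.h n k ω) (X.w F n ω)‖ ^ 2) μ ∧
      ∫ ω, ‖rowMul (X.h n k ω) (X.w F n ω)‖ ^ 2 ∂μ ≤ 1 := by
  refine integrable_of_lintegral_ofReal_le
    ((hX.measurable_rowMul_w F n (hX.measurable_h n k)).norm.pow_const 2) (fun _ => by positivity)
    zero_le_one ?_
  rw [hX.lintegral_own hZF F n k (f := fun t => ENNReal.ofReal (t ^ 2)) (by fun_prop),
    lintegral_normSq_complexGaussian, ENNReal.ofReal_one]

theorem integral_log_own (hX : X.IsModel μ) (hZF : (N - 1) * K < M) (F : NullBasis M N K)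
    (n : Fin N) (k : Fin K) {s : ℝ} (hs : 0 ≤ s) :
    Integrable (fun ω => Real.logb 2 (1 + s * ‖rowMul (X.h n k ω) (X.w F n ω)‖ ^ 2)) μ ∧
      ∫ ω, Real.logb 2 (1 + s * ‖rowMul (X.h n k ω) (X.w F n ω)‖ ^ 2) ∂μ
        = Real.logb 2 (Real.exp 1) * expE1 s := by
  have hm : Measurable fun ω => Real.log (1 + s * ‖rowMul (X.h n k ω) (X.w F n ω)‖ ^ 2) :=
    Real.measurable_log.comp (measurable_const.add (measurable_const.mul
      ((hX.measurable_rowMul_w F n (hX.measurable_h n k)).norm.pow_const 2)))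
  have h0 : ∀ ω, 0 ≤ Real.log (1 + s * ‖rowMul (X.h n k ω) (X.w F n ω)‖ ^ 2) := fun ω =>
    Real.log_nonneg (by
      have : 0 ≤ s * ‖rowMul (X.h n k ω) (X.w F n ω)‖ ^ 2 := by positivity
      linarith)
  have hl := hX.lintegral_own hZF F n k (f := fun t => ENNReal.ofReal (Real.log (1 + s * t ^ 2)))
    (Real.measurable_log.comp (by fun_prop)).ennreal_ofReal
  rw [lintegral_log_complexGaussian hs] at hl
  have hint := (integrable_of_lintegral_ofReal_le hm h0 (expE1_nonneg hs) hl.le).1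
  have hval : ∫ ω, Real.log (1 + s * ‖rowMul (X.h n k ω) (X.w F n ω)‖ ^ 2) ∂μ = expE1 s := by
    rw [integral_eq_lintegral_of_nonneg_ae (Filter.Eventually.of_forall h0)
      hm.aestronglyMeasurable, hl, ENNReal.toReal_ofReal (expE1_nonneg hs)]
  constructor
  · exact hint.div_const _
  · simp only [Real.logb]
    rw [integral_div, hval, Real.log_exp]
    ring

theorem integrable_leak (hX : X.IsModel μ) (hM : 2 ≤ M) (hZF : (N - 1) * K < M)
    (F : NullBasis M N K) (n : Fin N) (k : Fin K) :
    Integrable (X.leak F n k) μ ∧ ∫ ω, X.leak F n k ω ∂μ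
      ≤ Real.Gamma ((2 * (M : ℝ) - 1) / ((M : ℝ) - 1)) *
        (2 : ℝ) ^ (-((sys.bits n k : ℝ) / ((M : ℝ) - 1))) * sys.S3 n k := by
  set c : ℝ := Real.Gamma ((2 * (M : ℝ) - 1) / ((M : ℝ) - 1)) *
    (2 : ℝ) ^ (-((sys.bits n k : ℝ) / ((M : ℝ) - 1))) with hc
  have hM' : (2 : ℝ) ≤ M := by exact_mod_cast hM
  have hc0 : 0 ≤ c := by
    have : 0 < (2 * (M : ℝ) - 1) / ((M : ℝ) - 1) := div_pos (by linarith) (by linarith)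
    have := Real.Gamma_pos_of_pos this
    positivity
  have hT : ∀ i ∈ Finset.univ.erase n,
      Integrable (fun ω => ‖rowMul (X.h n k ω) (X.w F i ω)‖ ^ 2) μ ∧
        ∫ ω, ‖rowMul (X.h n k ω) (X.w F i ω)‖ ^ 2 ∂μ ≤ c := fun i hi =>
    integrable_of_lintegral_ofReal_le
      ((hX.measurable_rowMul_w F i (hX.measurable_h n k)).norm.pow_const 2)
      (fun _ => by positivity) hc0
      (hX.lintegral_cross_le hM hZF F (Finset.ne_of_mem_erase hi).symm k)
  have hsum : ∀ i ∈ Finset.univ.erase n, Integrable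
      (fun ω => ‖rowMul (X.h n k ω) (X.w F i ω)‖ ^ 2 * ∑ l, sys.power i l) μ := fun i hi =>
    (hT i hi).1.mul_const _
  constructor
  · exact (integrable_finsetSum _ hsum).const_mul _
  · simp only [leak]
    rw [integral_const_mul, integral_finsetSum _ hsum, System.S3, mul_left_comm]
    refine mul_le_mul_of_nonneg_left ?_ (sys.snr_nonneg n k)
    rw [Finset.mul_sum]
    refine Finset.sum_le_sum fun i hi => ?_
    rw [integral_mul_const]
    exact mul_le_mul_of_nonneg_right (hT i hi).2
      (Finset.sum_nonneg fun _ _ => sys.power_nonneg _ _)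

theorem integrable_instRateIdeal (hX : X.IsModel μ) (hZF : (N - 1) * K < M) (F : NullBasis M N K)
    (n : Fin N) (k : Fin K) : Integrable (X.instRateIdeal F n k) μ := by
  have hs1 : 0 ≤ sys.S1 n k := by
    rw [sys.S1_eq]
    exact add_nonneg (sys.S2_nonneg n k) (mul_nonneg (sys.snr_nonneg n k) (sys.power_nonneg n k))
  have hs2 := sys.S2_nonneg n k
  refine ((hX.integral_log_own hZF F n k hs1).1.sub (hX.integral_log_own hZF F n k hs2).1).congr
    (Filter.Eventually.of_forall fun ω => ?_)
  simp only [Pi.sub_apply, instRateIdeal]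
  rw [Real.logb_div (by positivity) (by positivity)]

theorem integrable_instRate (hX : X.IsModel μ) (hM : 2 ≤ M) (hZF : (N - 1) * K < M)
    (F : NullBasis M N K) (n : Fin N) (k : Fin K) : Integrable (X.instRate F n k) μ := by
  have ht : 0 ≤ sys.gain n k / sys.noiseVar n k * sys.power n k :=
    mul_nonneg (sys.snr_nonneg n k) (sys.power_nonneg n k)
  have hs2 := sys.S2_nonneg n k
  set t := sys.gain n k / sys.noiseVar n k * sys.power n k
  have hg : AEMeasurable (fun ω => ‖rowMul (X.h n k ω) (X.w F n ω)‖ ^ 2) μ :=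
    ((hX.measurable_rowMul_w F n (hX.measurable_h n k)).norm.pow_const 2).aemeasurable
  have hL : AEMeasurable (X.leak F n k) μ :=
    (hX.integrable_leak hM hZF F n k).1.aestronglyMeasurable.aemeasurable
  refine Integrable.congr ?_ ((hX.ae_instRate_eq hZF F n k).mono fun ω hω => hω.symm)
  -- Since `log(1 + x) ≤ x` and the denominator of the ratio is at least `1`, the rate is dominated
  -- by `t g / log 2`.
  refine Integrable.mono' (((hX.integrable_own hZF F n k).1.const_mul t).div_const (Real.log 2))
    ?_ (Filter.Eventually.of_forall fun ω => ?_)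
  · refine AEMeasurable.aestronglyMeasurable ?_
    refine (Real.measurable_log.comp_aemeasurable ?_).div_const _
    exact ((hg.const_mul t).div (((hg.const_mul _).const_add 1).add hL)).const_add 1
  · have hl := X.leak_nonneg F n k ω
    have hfrac : 0 ≤ t * ‖rowMul (X.h n k ω) (X.w F n ω)‖ ^ 2 /
        (1 + sys.S2 n k * ‖rowMul (X.h n k ω) (X.w F n ω)‖ ^ 2 + X.leak F n k ω) := by positivity
    rw [Real.norm_of_nonneg (logb_two_one_add_nonneg hfrac)]
    refine (logb_two_one_add_le hfrac).trans ?_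
    refine div_le_div_of_nonneg_right ?_ (Real.log_pos one_lt_two).le
    refine div_le_self (by positivity) ?_
    have : 0 ≤ sys.S2 n k * ‖rowMul (X.h n k ω) (X.w F n ω)‖ ^ 2 := by positivity
    linarith

theorem rateLoss_le (hX : X.IsModel μ) (hM : 2 ≤ M) (hZF : (N - 1) * K < M)
    (F : NullBasis M N K) (n : Fin N) (k : Fin K) : X.rateLoss F μ n k ≤ sys.lossBound n k := by
  have ht : 0 ≤ sys.gain n k / sys.noiseVar n k * sys.power n k :=
    mul_nonneg (sys.snr_nonneg n k) (sys.power_nonneg n k)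
  have hs2 := sys.S2_nonneg n k
  obtain ⟨hgi, hg1⟩ := hX.integrable_own hZF F n k
  obtain ⟨hLi, hL1⟩ := hX.integrable_leak hM hZF F n k
  obtain ⟨hlogi, hlog⟩ := hX.integral_log_own hZF F n k hs2
  have hideal := hX.integrable_instRateIdeal hZF F n k
  have hreal := hX.integrable_instRate hM hZF F n k
  set c : ℝ := Real.Gamma ((2 * (M : ℝ) - 1) / ((M : ℝ) - 1)) *
    (2 : ℝ) ^ (-((sys.bits n k : ℝ) / ((M : ℝ) - 1))) * sys.S3 n k with hc
  set s := sys.S2 n k with hs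
  have hc0 : 0 ≤ c := (integral_nonneg (X.leak_nonneg F n k)).trans hL1
  have hm : 0 < 1 + s + c := by linarith
  have hden : 0 < (1 + s + c) * Real.log 2 := mul_pos hm (Real.log_pos one_lt_two)
  let Y : Ω → ℝ := fun ω => s * ‖rowMul (X.h n k ω) (X.w F n ω)‖ ^ 2 + X.leak F n k ω
  have hYi : Integrable Y μ := (hgi.const_mul s).add hLi
  have hY : ∫ ω, Y ω ∂μ ≤ s + c := by
    have h1 : ∫ ω, Y ω ∂μ = s * (∫ ω, ‖rowMul (X.h n k ω) (X.w F n ω)‖ ^ 2 ∂μ)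
        + ∫ ω, X.leak F n k ω ∂μ := by
      rw [← integral_const_mul]
      exact integral_add (hgi.const_mul s) hLi
    rw [h1]
    have := mul_le_mul_of_nonneg_left hg1 hs2
    linarith
  -- Jensen's inequality by way of the tangent to `log₂` at `1 + s + c`. The slope is positive and
  -- `E Y ≤ s + c`, so the linear term has nonpositive mean; an upper bound on the mean of `Y` is
  -- enough.
  have hti : Integrable (fun ω => Real.logb 2 (1 + s + c)
      + (Y ω - (s + c)) / ((1 + s + c) * Real.log 2)) μ :=
    (integrable_const _).add ((hYi.sub (integrable_const _)).div_const _)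
  have hle : ∀ᵐ ω ∂μ, X.instRateIdeal F n k ω - X.instRate F n k ω
      ≤ (Real.logb 2 (1 + s + c) + (Y ω - (s + c)) / ((1 + s + c) * Real.log 2))
        - Real.logb 2 (1 + s * ‖rowMul (X.h n k ω) (X.w F n ω)‖ ^ 2) := by
    filter_upwards [hX.ae_instRate_eq hZF F n k] with ω hω
    have hl := X.leak_nonneg F n k ω
    have hg0 : 0 ≤ ‖rowMul (X.h n k ω) (X.w F n ω)‖ ^ 2 := by positivity
    rw [hω, instRateIdeal, sys.S1_eq]
    refine (logb_ideal_sub_le hs2 ht hg0 hl).trans ?_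
    have hpos : 0 < 1 + s * ‖rowMul (X.h n k ω) (X.w F n ω)‖ ^ 2 + X.leak F n k ω := by positivity
    have h1 := logb_two_le_tangent hpos hm
    have h2 : 1 + s * ‖rowMul (X.h n k ω) (X.w F n ω)‖ ^ 2 + X.leak F n k ω - (1 + s + c)
        = Y ω - (s + c) := by
      simp only [Y]
      ring
    rw [h2] at h1
    exact sub_le_sub_right h1 _
  have hint := integral_mono_ae (hideal.sub hreal) (hti.sub hlogi) hle
  have hlhs : X.rateLoss F μ n k
      = ∫ ω, (X.instRateIdeal F n k - X.instRate F n k) ω ∂μ := by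
    rw [rateLoss, rateIdeal, rate]
    exact (integral_sub hideal hreal).symm
  rw [hlhs]
  refine hint.trans ?_
  have hrhs : ∫ ω, (Real.logb 2 (1 + s + c) + (Y ω - (s + c)) / ((1 + s + c) * Real.log 2)) ∂μ
      ≤ Real.logb 2 (1 + s + c) := by
    have hdiv : Integrable (fun ω => (Y ω - (s + c)) / ((1 + s + c) * Real.log 2)) μ :=
      (hYi.sub (integrable_const _)).div_const _
    rw [integral_add (integrable_const _) hdiv,
      integral_div, integral_sub hYi (integrable_const _)]
    simp only [integral_const, probReal_univ, one_smul]
    have : (∫ ω, Y ω ∂μ - (s + c)) / ((1 + s + c) * Real.log 2) ≤ 0 :=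
      div_nonpos_of_nonpos_of_nonneg (by linarith) hden.le
    linarith
  calc _ = ∫ ω, (Real.logb 2 (1 + s + c) + (Y ω - (s + c)) / ((1 + s + c) * Real.log 2)) ∂μ
        - ∫ ω, Real.logb 2 (1 + s * ‖rowMul (X.h n k ω) (X.w F n ω)‖ ^ 2) ∂μ :=
        integral_sub hti hlogi
    _ ≤ Real.logb 2 (1 + s + c) - Real.logb 2 (Real.exp 1) * expE1 s := by
        rw [hlog]
        linarith
    _ = sys.lossBound n k := by rw [System.lossBound]

end RandomData.IsModel

end NOMA

theorem theorem2 {M N K : ℕ} (hM : 2 ≤ M) (hK : 2 ≤ K) (hZF : (N - 1) * K < M)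
    (sys : NOMA.System M N K) (F : NOMA.NullBasis M N K)
    {Ω : Type*} [MeasurableSpace Ω] (μ : MeasureTheory.Measure Ω)
    [MeasureTheory.IsProbabilityMeasure μ]
    (X : NOMA.RandomData sys Ω) (hX : X.IsModel μ) (n : Fin N) (k : Fin K) :
    MeasureTheory.Integrable (X.instRateIdeal F n k) μ ∧
    MeasureTheory.Integrable (X.instRate F n k) μ ∧
    X.rateLoss F μ n k ≤ sys.lossBound n k :=
  ⟨hX.integrable_instRateIdeal hZF F n k, hX.integrable_instRate hM hZF F n k,
    hX.rateLoss_le hM hZF F n k⟩
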